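/- **Setting.** All quantum systems are finite tensor products of qudits of odd prime dimension (possibly the trivial one-dimensional system), and $\log=\log_2$ with $\log 0=-\infty$, $\log\infty=\infty$. For a qudit of odd prime dimension $p$ let $X|j\rangle=|j+1\rangle$, $Z|j\rangle=e^{2\pi i j/p}|j\rangle$, $\tau=e^{(p+1)\pi i/p}$ and $T_{(a_1,a_2)}=\tau^{-a_1a_2}Z^{a_1}X^{a_2}$ for $(a_1,a_2)\in\mathbb Z_p^2$; on composite systems take tensor products. For a system of dimension $d$ put $A_0=\frac1d\sum_u T_u$, $A_u=T_uA_0T_u^\dagger$ and $W_X(u)=\frac1d\operatorname{tr}[A_uX]$. A state $\rho$ is free if $W_\rho(u)\ge 0$ for all $u$. A channel $\mathcal F_{A\to B}$ is CPWP if for every reference system $R$ the map $\mathrm{id}_R\otimes\mathcal F$ sends free states of $RA$ to free states of $RB$. For a linear map $\mathcal E_{A\to B}$ let $\mathcal M(\mathcal E)=\log\max_u\sum_v|W_{\mathcal E(A_u)}(v)|$. Let $D_{\max}(\rho\|\sigma)=\inf\{\lambda\in\mathbb R:\rho\le 2^\lambda\sigma\}$ (with value $+\infty$ if there is no such $\lambda$)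 and $D_{\max}(\mathcal N\|\mathcal E)=\sup_\psi D_{\max}((\mathrm{id}\otimes\mathcal N)(\psi)\,\|\,(\mathrm{id}\otimes\mathcal E)(\psi))$, the supremum being over pure states $\psi_{RA}$ with $R\cong A$. The max-thauma of a channel $\mathcal N$ is $$\theta_{\max}(\mathcal N)=\inf\{D_{\max}(\mathcal N\|\mathcal E):\ \mathcal E\text{ completely positive},\ \mathcal M(\mathcal E)\le 0\}.$$ Let $|T\rangle=\frac1{\sqrt3}(\xi|0\rangle+|1\rangle+\xi^{-1}|2\rangle)$ with $\xi=e^{2\pi i/9}$. For $n\ge1$, $k\ge 0$ and $\varepsilon\in[0,1]$, an $(n,k,\varepsilon)$ $T$-magic distillation protocol for a channel $\mathcal N_{A\to B}$ consists of reference systems $R_1,\dots,R_n$ and CPWP channels $\mathcal F^{(1)}_{\emptyset\to R_1A}$, $\mathcal F^{(i+1)}_{R_iB\to R_{i+1}A}$ ($1\le i<n$) and $\mathcal F^{(n+1)}_{R_nB\to S}$, where $S$ consists of $k$ qutrits, such that the state $$\omega_S=\mathcal F^{(n+1)}\circ(\mathrm{id}\otimes\mathcal N)\circ\mathcal F^{(n)}\circ\cdots\circ\mathcal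 F^{(2)}\circ(\mathrm{id}\otimes\mathcal N)\circ\mathcal F^{(1)}(1)$$ satisfies $\langle T|^{\otimes k}\omega_S|T\rangle^{\otimes k}\ge 1-\varepsilon$. A real number $R$ is an achievable rate if for all $\varepsilon\in(0,1]$, all $\delta>0$ and all sufficiently large $n$ there is an $(n,k,\varepsilon)$ protocol for some integer $k\ge n(R-\delta)$; $C_T(\mathcal N)$ is the supremum of the achievable rates. **Proposition.** Let $\mathcal N$ be a quantum channel. Every $(n,k,\varepsilon)$ $T$-magic distillation protocol for $\mathcal N$ has rate $$\frac kn\le\frac{1}{\log(1+2\sin(\pi/18))}\left(\theta_{\max}(\mathcal N)+\frac{\log(1/[1-\varepsilon])}{n}\right)$$ (the right-hand side is $+\infty$ if $\varepsilon=1$). Consequently, $$C_T(\mathcal N)\le\frac{\theta_{\max}(\mathcal N)}{\log(1+2\sin(\pi/18))}.$$ -/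

import Mathlib

open scoped ENNReal ComplexOrder

noncomputable section

/-! ## Quantum systems and discrete phase space -/

/-- Finite-dimensional quantum systems of odd dimension, built as tensor products of qudits of odd
prime dimension; `unit` is the trivial one-dimensional system. -/
inductive QSystem : Type
  | unit : QSystem
  | qudit (p : ℕ) (prime : p.Prime) (odd : Odd p) : QSystem
  | tensor (A B : QSystem) : QSystem

namespace QSystem

/-- Labels of the computational basis. -/
@[reducible] def Basis : QSystem → Type
  | unit => Unit
  | qudit p _ _ => ZMod p
  | tensor A B => Basis A × Basis B

/-- Points of the discrete phase space. -/
@[reducible] def Phase : QSystem → Type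
  | unit => Unit
  | qudit p _ _ => ZMod p × ZMod p
  | tensor A B => Phase A × Phase B

instance instFintypeBasis : (A : QSystem) → Fintype A.Basis
  | unit => inferInstanceAs (Fintype Unit)
  | qudit p hp _ => haveI : NeZero p := ⟨hp.ne_zero⟩; inferInstanceAs (Fintype (ZMod p))
  | tensor A B =>
      haveI := instFintypeBasis A; haveI := instFintypeBasis B
      inferInstanceAs (Fintype (A.Basis × B.Basis))

instance instDecidableEqBasis : (A : QSystem) → DecidableEq A.Basis
  | unit => inferInstanceAs (DecidableEq Unit)
  | qudit p _ _ => inferInstanceAs (DecidableEq (ZMod p))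
  | tensor A B =>
      haveI := instDecidableEqBasis A; haveI := instDecidableEqBasis B
      inferInstanceAs (DecidableEq (A.Basis × B.Basis))

instance instFintypePhase : (A : QSystem) → Fintype A.Phase
  | unit => inferInstanceAs (Fintype Unit)
  | qudit p hp _ => haveI : NeZero p := ⟨hp.ne_zero⟩; inferInstanceAs (Fintype (ZMod p × ZMod p))
  | tensor A B =>
      haveI := instFintypePhase A; haveI := instFintypePhase B
      inferInstanceAs (Fintype (A.Phase × B.Phase))

instance instZeroPhase : (A : QSystem) → Zero A.Phase
  | unit => inferInstanceAs (Zero Unit)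
  | qudit p _ _ => inferInstanceAs (Zero (ZMod p × ZMod p))
  | tensor A B =>
      haveI := instZeroPhase A; haveI := instZeroPhase B
      inferInstanceAs (Zero (A.Phase × B.Phase))

/-- The Hilbert space dimension. -/
def dim (A : QSystem) : ℕ := Fintype.card A.Basis

/-- `k` copies of a system. -/
def pow (A : QSystem) : ℕ → QSystem
  | 0 => unit
  | k + 1 => tensor (pow A k) A

end QSystem

open QSystem

/-- Linear operators on the Hilbert space of `A`, as matrices in the computational basis. -/
abbrev Op (A : QSystem) : Type := Matrix A.Basis A.Basis ℂ

/-- The shift operator `X |j⟩ = |j + 1⟩`. -/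
def shiftX (p : ℕ) : Matrix (ZMod p) (ZMod p) ℂ :=
  Matrix.of fun i j => if i = j + 1 then 1 else 0

/-- The boost operator `Z |j⟩ = ω ^ j |j⟩` with `ω = exp (2 π i / p)`. -/
def boostZ (p : ℕ) : Matrix (ZMod p) (ZMod p) ℂ :=
  Matrix.diagonal fun j => Complex.exp (2 * Real.pi * Complex.I / p) ^ j.val

/-- The Heisenberg-Weyl operators `τ ^ (-a₁ a₂) Z ^ a₁ X ^ a₂`, with `τ = exp ((p + 1) π i / p)`,
and their tensor products. (`τ ^ p = 1` for odd `p`, so representatives do not matter.) -/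
def weyl : (A : QSystem) → A.Phase → Op A
  | .unit, _ => 1
  | .qudit p hp _, a =>
      haveI : NeZero p := ⟨hp.ne_zero⟩
      (Complex.exp ((p + 1) * Real.pi * Complex.I / p) ^ (-((a.1.val : ℤ) * (a.2.val : ℤ)))) •
        (boostZ p ^ a.1.val * shiftX p ^ a.2.val)
  | .tensor A B, a => Matrix.kronecker (weyl A a.1) (weyl B a.2)

/-- The phase-space point operator at the origin, `A_0 = (1 / d) ∑ T_u`. -/
def phaseOpZero (A : QSystem) : Op A := (1 / (A.dim : ℂ)) • ∑ u : A.Phase, weyl A u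

/-- The phase-space point operators `A_u = T_u A_0 T_u†`. -/
def phaseOp (A : QSystem) (u : A.Phase) : Op A :=
  weyl A u * phaseOpZero A * (weyl A u).conjTranspose

/-- The discrete Wigner function `W_X(u) = tr[A_u X] / d`. It is complex-valued for a general
operator and real for a Hermitian one. -/
def wigner {A : QSystem} (X : Op A) (u : A.Phase) : ℂ :=
  (1 / (A.dim : ℂ)) * (phaseOp A u * X).trace

/-- A density operator. -/
def IsState {A : QSystem} (ρ : Op A) : Prop := ρ.PosSemidef ∧ ρ.trace = 1

/-- The set `W₊` of states with non-negative Wigner function. -/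
def wignerPolytope (A : QSystem) : Set (Op A) :=
  {ρ | IsState ρ ∧ ∀ u, 0 ≤ wigner ρ u}

/-! ## Linear maps, channels, CPWP channels -/

/-- `id_R ⊗ N` for a linear map `N` on matrices. -/
def idTensor {r a b : Type*} (N : Matrix a a ℂ →ₗ[ℂ] Matrix b b ℂ)
    (X : Matrix (r × a) (r × a) ℂ) : Matrix (r × b) (r × b) ℂ :=
  Matrix.of fun x y => N (Matrix.of fun i j => X (x.1, i) (y.1, j)) x.2 y.2

/-- Complete positivity. -/
def IsCP {A B : QSystem} (N : Op A →ₗ[ℂ] Op B) : Prop :=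
  ∀ (m : ℕ) (X : Matrix (Fin m × A.Basis) (Fin m × A.Basis) ℂ),
    X.PosSemidef → (idTensor N X).PosSemidef

/-- A quantum channel: a completely positive and trace-preserving linear map. -/
def IsChannel {A B : QSystem} (N : Op A →ₗ[ℂ] Op B) : Prop :=
  IsCP N ∧ ∀ X, (N X).trace = X.trace

/-- A channel is completely positive-Wigner-preserving if, with every reference system, it maps
states with non-negative Wigner function to such states. -/
def IsCPWPChannel {A B : QSystem} (N : Op A →ₗ[ℂ] Op B) : Prop :=
  IsChannel N ∧ ∀ (R : QSystem) (ρ : Op (tensor R A)), ρ ∈ wignerPolytope (tensor R A) →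
    (idTensor N ρ : Op (tensor R B)) ∈ wignerPolytope (tensor R B)

/-! ## Mana and max-thauma -/

/-- The extended base-two logarithm, with `log 0 = -∞` and `log ∞ = ∞`. -/
def log2 (x : ℝ≥0∞) : EReal := ENNReal.log x / ((Real.log 2 : ℝ) : EReal)

/-- The Wigner trace norm `∑ |W_X(u)|`. -/
def wignerTraceNorm {A : QSystem} (X : Op A) : ℝ≥0∞ := ∑ u : A.Phase, ‖wigner X u‖ₑ

/-- The mana of a linear map, the logarithm of the maximum over `u` of the Wigner trace norm of
`N(A_u)`. -/
def mana {A B : QSystem} (N : Op A →ₗ[ℂ] Op B) : EReal :=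
  log2 (⨆ u : A.Phase, wignerTraceNorm (N (phaseOp A u)))

/-- The max-relative entropy `min {l : ρ ≤ 2 ^ l σ}`, equal to `∞` if there is no such `l`. -/
def dMax {A : QSystem} (ρ σ : Op A) : EReal :=
  sInf ((fun l : ℝ => (l : EReal)) '' {l : ℝ | ((((2 : ℝ) ^ l : ℝ) : ℂ) • σ - ρ).PosSemidef})

/-- The max-divergence of completely positive maps: the supremum over the pure states of `R ⊗ A`,
with `R` isomorphic to `A`. -/
def dMaxMap {A B : QSystem} (N E : Op A →ₗ[ℂ] Op B) : EReal :=
  ⨆ ψ : {ψ : (tensor A A).Basis → ℂ // ∑ x, ‖ψ x‖ ^ 2 = 1},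
    dMax (A := tensor A B) (idTensor N (Matrix.vecMulVec ψ.1 (star ψ.1)))
      (idTensor E (Matrix.vecMulVec ψ.1 (star ψ.1)))

/-- The max-thauma of a channel: the infimum of the max-divergence over the completely positive
maps with non-positive mana. -/
def maxThauma {A B : QSystem} (N : Op A →ₗ[ℂ] Op B) : EReal :=
  ⨅ E : {E : Op A →ₗ[ℂ] Op B // IsCP E ∧ mana E ≤ 0}, dMaxMap N E.1

/-! ## Magic state distillation from a channel -/

/-- A protocol with `n ≥ 1` uses of a channel from `A` to `B`, interleaved with CPWP channels, that
outputs a state of `S`. The reference systems are `R 0, …, R (n - 1)`; the free channels are the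
preparation, `mid i` between uses `i` and `i + 1` (uses counted from `0`, so only `i + 1 < n`
matters), and the final one. -/
structure DistProtocol (A B S : QSystem) (n : ℕ) where
  pos : 0 < n
  R : ℕ → QSystem
  prep : Op unit →ₗ[ℂ] Op (tensor (R 0) A)
  prep_free : IsCPWPChannel prep
  mid : (i : ℕ) → Op (tensor (R i) B) →ₗ[ℂ] Op (tensor (R (i + 1)) A)
  mid_free : ∀ i, i + 1 < n → IsCPWPChannel (mid i)
  final : Op (tensor (R (n - 1)) B) →ₗ[ℂ] Op S
  final_free : IsCPWPChannel final

namespace DistProtocol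

variable {A B S : QSystem} {n : ℕ}

/-- The state before use `i` of the channel `N`, uses counted from `0`. -/
def state (P : DistProtocol A B S n) (N : Op A →ₗ[ℂ] Op B) : (i : ℕ) → Op (tensor (P.R i) A)
  | 0 => P.prep 1
  | i + 1 => P.mid i (idTensor N (P.state N i))

/-- The output state, after `n` uses of `N` and the final free channel. -/
def output (P : DistProtocol A B S n) (N : Op A →ₗ[ℂ] Op B) : Op S :=
  P.final (idTensor N (P.state N (n - 1)))

end DistProtocol

/-- The vector `|ψ⟩ ⊗ ⋯ ⊗ |ψ⟩` (`k` factors). -/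
def vecPow {M : QSystem} (ψ : M.Basis → ℂ) : (k : ℕ) → (M.pow k).Basis → ℂ
  | 0 => fun _ => 1
  | k + 1 => fun x => vecPow ψ k x.1 * ψ x.2

/-- The fidelity `⟨φ| ω |φ⟩` of a state with a pure state. -/
def fidelityWith {S : QSystem} (φ : S.Basis → ℂ) (ω : Op S) : ℝ :=
  (star φ ⬝ᵥ (ω.mulVec φ)).re

/-- The protocol `P`, used with the channel `N`, is an `(n, k, ε)` protocol for `ψ`-magic
distillation. -/
def IsDistillation {A B M : QSystem} (ψ : M.Basis → ℂ) (N : Op A →ₗ[ℂ] Op B) (n k : ℕ) (ε : ℝ)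
    (P : DistProtocol A B (M.pow k) n) : Prop :=
  1 - ε ≤ fidelityWith (vecPow ψ k) (P.output N)

/-- The rate `r` is achievable for `ψ`-magic distillation from `N`. The number of copies is an
integer `k` with `k ≥ n (r - δ)`. -/
def IsAchievableRate {A B M : QSystem} (ψ : M.Basis → ℂ) (N : Op A →ₗ[ℂ] Op B) (r : ℝ) : Prop :=
  ∀ ε : ℝ, 0 < ε → ε ≤ 1 → ∀ δ : ℝ, 0 < δ → ∀ᶠ n : ℕ in Filter.atTop,
    ∃ k : ℕ, (n : ℝ) * (r - δ) ≤ k ∧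
      ∃ P : DistProtocol A B (M.pow k) n, IsDistillation ψ N n k ε P

/-- The `ψ`-distillable magic of a channel: the supremum of the achievable rates. -/
def distillableMagic {A B M : QSystem} (ψ : M.Basis → ℂ) (N : Op A →ₗ[ℂ] Op B) : EReal :=
  sSup ((fun r : ℝ => (r : EReal)) '' {r : ℝ | IsAchievableRate ψ N r})

/-! ## The qutrit `T` state -/

/-- The qutrit system. -/
def qutrit : QSystem := .qudit 3 Nat.prime_three (by decide)

/-- The primitive ninth root of unity `ξ = exp (2 π i / 9)`. -/
def xi : ℂ := Complex.exp (2 * Real.pi * Complex.I / 9)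

/-- The qutrit gate `T = diag (ξ, 1, ξ⁻¹)`. -/
def tGate : Op qutrit := Matrix.diagonal (![xi, 1, xi⁻¹] : Fin 3 → ℂ)

/-- The qutrit state `|+⟩ = (|0⟩ + |1⟩ + |2⟩) / √3`. -/
def plusVec : qutrit.Basis → ℂ := fun _ => ((1 / Real.sqrt 3 : ℝ) : ℂ)

/-- The `T` magic state `|T⟩ = T |+⟩`. -/
def tVec : qutrit.Basis → ℂ := tGate.mulVec plusVec

/-- The real number `log₂ (1 + 2 sin (π / 18))`. -/
def logConst : ℝ := Real.logb 2 (1 + 2 * Real.sin (Real.pi / 18))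

end

section MagicDistillation

open QSystem Matrix Finset

/-! The phase-space point operators `A_u` form a basis that is orthogonal for the trace form, and
Wigner functions are coordinates in it, so `wignerTraceNorm` is an ℓ¹ norm. Three facts carry the
bound.

Norm: free channels do not increase this norm (`IsCPWPChannel.wignerTraceNorm_le`), and neither does
`id ⊗ E` when `mana E ≤ 0` (`wignerTraceNorm_idTensor_le`). Running a protocol with such an `E` in
place of `N` therefore gives an output of norm at most 1.

Domination: if `2^l E - N` is completely positive, the output with `N` lies below `2^(ln)` times the
output with `E` (`smul_output_sub_posSemidef`).

Witness: put `s = 2 sin(π/18)`. Some operator above `|T⟩⟨T|` has all phase-space traces `tr[A_u Y]`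
of modulus at most `1/(1+s)`. Tensor powers keep both properties, so a positive operator of Wigner
trace norm at most 1 has fidelity at most `(1+s)^(-k)` with `T^{⊗k}` (`fidelityWith_tVec_le`).

Together `1 - ε ≤ 2^(ln) (1+s)^(-k)`. Taking logarithms and the infimum over `E` and `l` bounds the
rate; with `ε` fixed and `n → ∞` the error term vanishes, which bounds the distillable magic. -/

lemma QSystem.fintypeBasis_tensor (A B : QSystem) :
    instFintypeBasis (tensor A B) = instFintypeProd A.Basis B.Basis := rfl

lemma QSystem.dim_tensor (A B : QSystem) : (tensor A B).dim = A.dim * B.dim :=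
  Fintype.card_prod A.Basis B.Basis

lemma QSystem.dim_pos (A : QSystem) : 0 < A.dim := by
  induction A with
  | unit => exact Nat.one_pos
  | qudit p hp _ =>
    have : NeZero p := ⟨hp.ne_zero⟩
    exact Fintype.card_pos (α := ZMod p)
  | tensor A B hA hB => rw [dim_tensor]; positivity

lemma QSystem.dim_qudit (p : ℕ) (hp : p.Prime) (ho : Odd p) : (qudit p hp ho).dim = p := by
  have : NeZero p := ⟨hp.ne_zero⟩
  exact ZMod.card p

lemma QSystem.dim_ne_zero (A : QSystem) : (A.dim : ℂ) ≠ 0 :=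
  Nat.cast_ne_zero.mpr A.dim_pos.ne'

/-! ### A single qudit -/

section Qudit

variable {p : ℕ} [NeZero p]

lemma stdAddChar_star (x : ZMod p) : star (ZMod.stdAddChar x) = ZMod.stdAddChar (-x) := by
  rw [ZMod.stdAddChar_apply, ZMod.stdAddChar_apply, AddChar.map_neg_eq_inv, Circle.coe_inv_eq_conj]
  rfl

lemma shiftX_pow_apply (n : ℕ) (i j : ZMod p) :
    (shiftX p ^ n) i j = if i = j + n then 1 else 0 := by
  induction n generalizing i with
  | zero => simp [Matrix.one_apply]
  | succ n ih =>
    rw [pow_succ', Matrix.mul_apply, Finset.sum_eq_single (i - 1)]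
    · rw [ih]
      simp only [shiftX, Matrix.of_apply, sub_add_cancel, if_true, one_mul, Nat.cast_add,
        Nat.cast_one, sub_eq_iff_eq_add, add_assoc]
    · intro b _ hb
      have : i ≠ b + 1 := fun h => hb (by rw [h]; ring)
      simp [shiftX, this]
    · simp

lemma boostZ_pow_mul_apply (a : ZMod p) (M : Matrix (ZMod p) (ZMod p) ℂ) (i j : ZMod p) :
    (boostZ p ^ a.val * M) i j = ZMod.stdAddChar (a * i) * M i j := by
  rw [boostZ, Matrix.diagonal_pow, Matrix.diagonal_mul]
  congr 1
  have h1 : a * i = (((a.val * i.val : ℕ) : ℤ) : ZMod p) := by simp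
  rw [h1, ZMod.stdAddChar_coe, Pi.pow_apply, ← Complex.exp_nat_mul, ← Complex.exp_nat_mul]
  congr 1
  push_cast
  ring

/-- For odd `p`, `τ = ω^((p+1)/2)`, and `(p+1)/2` is the inverse of 2 modulo `p`. All phases thus
become values of one additive character of `ZMod p`, and phase computations become linear algebra
over `ZMod p`. -/
lemma weyl_phase_eq (hp : p.Prime) (ho : Odd p) (a : ZMod p × ZMod p) :
    Complex.exp ((p + 1) * Real.pi * Complex.I / p) ^ (-((a.1.val : ℤ) * (a.2.val : ℤ))) =
      ZMod.stdAddChar (-(((p + 1) / 2 : ℕ) : ZMod p) * (a.1 * a.2)) := by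
  have h2 : (((p + 1) / 2 : ℕ) : ℂ) = ((p : ℂ) + 1) / 2 := by
    obtain ⟨m, rfl⟩ := ho
    rw [show (2 * m + 1 + 1) / 2 = m + 1 by omega]
    push_cast; ring
  generalize (p + 1) / 2 = q at h2 ⊢
  have h1 : -(q : ZMod p) * (a.1 * a.2) =
      ((-((q : ℤ) * ((a.1.val : ℤ) * (a.2.val : ℤ))) : ℤ) : ZMod p) := by
    push_cast; simp
  rw [h1, ZMod.stdAddChar_coe, ← Complex.exp_int_mul]
  congr 1
  push_cast
  rw [h2]
  ring

lemma half_mul_two (ho : Odd p) : (((p + 1) / 2 : ℕ) : ZMod p) * 2 = 1 := by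
  have h : (p + 1) / 2 * 2 = p + 1 := by
    obtain ⟨m, rfl⟩ := ho
    omega
  calc (((p + 1) / 2 : ℕ) : ZMod p) * 2 = (((p + 1) / 2 * 2 : ℕ) : ZMod p) := by push_cast; ring
    _ = 1 := by rw [h]; simp

lemma sum_stdAddChar_mul (b : ZMod p) :
    ∑ x : ZMod p, ZMod.stdAddChar (x * b) = if b = 0 then (p : ℂ) else 0 := by
  rw [AddChar.sum_mulShift b (ZMod.isPrimitive_stdAddChar p), ZMod.card]
  split_ifs <;> simp

lemma weyl_qudit_apply (hp : p.Prime) (ho : Odd p) (a : ZMod p × ZMod p) (i j : ZMod p) :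
    weyl (.qudit p hp ho) a i j =
      if i = j + a.2 then
        ZMod.stdAddChar (a.1 * i - (((p + 1) / 2 : ℕ) : ZMod p) * (a.1 * a.2)) else 0 := by
  have := weyl_phase_eq hp ho a
  change ((Complex.exp ((p + 1) * Real.pi * Complex.I / p) ^ (-((a.1.val : ℤ) * (a.2.val : ℤ)))) •
        (boostZ p ^ a.1.val * shiftX p ^ a.2.val)) i j = _
  rw [this, Matrix.smul_apply, boostZ_pow_mul_apply, shiftX_pow_apply, ZMod.natCast_zmod_val]
  split_ifs
  · rw [smul_eq_mul, mul_one, ← AddChar.map_add_eq_mul]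
    congr 1; ring
  · simp

/-- The shift exponent is forced to be `i - j`; character orthogonality in the boost exponent then
leaves the parity operator `|j⟩ ↦ |-j⟩`. -/
lemma phaseOpZero_qudit_apply (hp : p.Prime) (ho : Odd p) (i j : ZMod p) :
    phaseOpZero (.qudit p hp ho) i j = if i + j = 0 then 1 else 0 := by
  have hp0 : (p : ℂ) ≠ 0 := Nat.cast_ne_zero.mpr (NeZero.ne p)
  set h := (((p + 1) / 2 : ℕ) : ZMod p)
  have h2 : h * 2 = 1 := half_mul_two ho
  rw [phaseOpZero, dim_qudit, Matrix.smul_apply, Matrix.sum_apply]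
  have : ∑ u : (qudit p hp ho).Phase, weyl (.qudit p hp ho) u i j =
      ∑ u : ZMod p × ZMod p, if i = j + u.2 then
        ZMod.stdAddChar (u.1 * i - h * (u.1 * u.2)) else 0 :=
    Finset.sum_congr rfl fun u _ => weyl_qudit_apply hp ho u i j
  rw [this, Fintype.sum_prod_type]
  have : ∀ x : ZMod p, ∑ y : ZMod p, (if i = j + y then
        ZMod.stdAddChar (x * i - h * (x * y)) else 0) = ZMod.stdAddChar (x * (h * (i + j))) := by
    intro x
    rw [Finset.sum_eq_single (i - j)]
    · rw [if_pos (by ring)]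
      congr 1
      linear_combination (- x * i) * h2
    · intro b _ hb
      exact if_neg fun e => hb (by rw [e]; ring)
    · simp
  simp only [this]
  rw [sum_stdAddChar_mul]
  have : h * (i + j) = 0 ↔ i + j = 0 := by
    constructor
    · intro e
      linear_combination 2 * e - (i + j) * h2
    · intro e; rw [e, mul_zero]
  simp only [this]
  split_ifs <;> simp [hp0]

lemma phaseOp_qudit_apply (hp : p.Prime) (ho : Odd p) (a : ZMod p × ZMod p) (i j : ZMod p) :
    phaseOp (.qudit p hp ho) a i j =
      if i + j = 2 * a.2 then ZMod.stdAddChar (a.1 * (i - j)) else 0 := by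
  have e1 : phaseOp (.qudit p hp ho) a i j = ∑ l : ZMod p, (∑ k : ZMod p,
      weyl (.qudit p hp ho) a i k * phaseOpZero (.qudit p hp ho) k l) *
        star (weyl (.qudit p hp ho) a j l) := rfl
  rw [e1]
  simp only [weyl_qudit_apply, phaseOpZero_qudit_apply]
  rw [Finset.sum_eq_single (j - a.2), Finset.sum_eq_single (i - a.2)]
  · rw [if_pos (c := i = i - a.2 + a.2) (by ring), if_pos (c := j = j - a.2 + a.2) (by ring)]
    have : i - a.2 + (j - a.2) = 0 ↔ i + j = 2 * a.2 := by
      constructor <;> intro e <;> linear_combination e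
    simp only [this]
    split_ifs
    · rw [mul_one, stdAddChar_star, ← AddChar.map_add_eq_mul]
      congr 1; ring
    · simp
  · intro b _ hb
    rw [if_neg fun e => hb (by rw [e]; ring), zero_mul]
  · simp
  · intro b _ hb
    rw [if_neg (c := j = b + a.2) fun e => hb (by rw [e]; ring), star_zero, mul_zero]
  · simp

end Qudit

/-! ### General systems -/

lemma weyl_tensor (A B : QSystem) (u : (tensor A B).Phase) :
    weyl (tensor A B) u = kronecker (weyl A u.1) (weyl B u.2) := rfl

lemma phaseOpZero_tensor (A B : QSystem) :
    phaseOpZero (tensor A B) = kronecker (phaseOpZero A) (phaseOpZero B) := by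
  ext ⟨i, i'⟩ ⟨j, j'⟩
  have e : ∀ (M : Op A) (M' : Op B),
      kronecker M M' (i, i') (j, j') = M i j * M' i' j' := fun _ _ => rfl
  simp only [e, phaseOpZero, dim_tensor, Matrix.smul_apply, Matrix.sum_apply,
    weyl_tensor, Fintype.sum_prod_type, smul_eq_mul, ← Finset.mul_sum, ← Finset.sum_mul]
  push_cast
  have hA := A.dim_ne_zero
  have hB := B.dim_ne_zero
  field_simp

lemma phaseOp_tensor (A B : QSystem) (u : (tensor A B).Phase) :
    phaseOp (tensor A B) u = kronecker (phaseOp A u.1) (phaseOp B u.2) := by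
  -- `fintypeBasis_tensor` exposes the product instance that the Kronecker lemmas expect.
  rw [phaseOp, weyl_tensor, phaseOpZero_tensor, fintypeBasis_tensor]
  unfold kronecker
  rw [conjTranspose_kronecker, ← mul_kronecker_mul, ← mul_kronecker_mul]
  rfl

lemma phaseOp_tensor_apply (A B : QSystem) (u : (tensor A B).Phase) (x y : (tensor A B).Basis) :
    phaseOp (tensor A B) u x y = phaseOp A u.1 x.1 y.1 * phaseOp B u.2 x.2 y.2 := by
  rw [phaseOp_tensor]; rfl

lemma phaseOp_unit_apply (u : unit.Phase) (i j : unit.Basis) : phaseOp unit u i j = 1 := by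
  have h0 : phaseOpZero unit = 1 := by
    have : unit.dim = 1 := rfl
    have h2 : ∑ u : unit.Phase, weyl unit u = weyl unit () := Finset.sum_singleton _ _
    rw [phaseOpZero, this, h2]
    simp [weyl]
  have : phaseOp unit u = 1 := by
    rw [phaseOp, h0]
    simp [weyl]
  rw [this]
  rfl

/-- Transposition acts on phase space by reversing momentum, `(a₁, a₂) ↦ (-a₁, a₂)`. -/
lemma exists_phaseOp_transpose (A : QSystem) (u : A.Phase) :
    ∃ v, (phaseOp A u)ᵀ = phaseOp A v := by
  induction A with
  | unit => exact ⟨u, by ext i j; simp [phaseOp_unit_apply]⟩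
  | qudit p hp ho =>
    have : NeZero p := ⟨hp.ne_zero⟩
    refine ⟨(-u.1, u.2), ?_⟩
    ext i j
    rw [transpose_apply, phaseOp_qudit_apply, phaseOp_qudit_apply, add_comm i j]
    split_ifs
    · congr 1; ring
    · simp
  | tensor A B hA hB =>
    obtain ⟨v, hv⟩ := hA u.1
    obtain ⟨w, hw⟩ := hB u.2
    refine ⟨(v, w), ?_⟩
    ext i j
    rw [transpose_apply, phaseOp_tensor_apply, phaseOp_tensor_apply, ← hv, ← hw]
    rfl

/-- Completeness: `∑ A_u ⊗ A_u` is `d` times the swap operator. This yields the expansion `X = ∑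
W_X(u) A_u`. -/
lemma sum_phaseOp_mul_phaseOp (A : QSystem) (i j k l : A.Basis) :
    ∑ u, phaseOp A u i j * phaseOp A u k l = if i = l ∧ j = k then (A.dim : ℂ) else 0 := by
  induction A with
  | unit =>
    have : unit.dim = 1 := rfl
    simp only [phaseOp_unit_apply, this]
    simp
  | qudit p hp ho =>
    have : NeZero p := ⟨hp.ne_zero⟩
    set h := (((p + 1) / 2 : ℕ) : ZMod p)
    have h2 : h * 2 = 1 := half_mul_two ho
    change ZMod p at i j k l
    have e1 : ∑ u, phaseOp (qudit p hp ho) u i j * phaseOp (qudit p hp ho) u k l =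
      ∑ u : ZMod p × ZMod p, (if i + j = 2 * u.2 then ZMod.stdAddChar (u.1 * (i - j)) else 0) *
        (if k + l = 2 * u.2 then ZMod.stdAddChar (u.1 * (k - l)) else 0) :=
      Finset.sum_congr rfl fun u _ => by rw [phaseOp_qudit_apply, phaseOp_qudit_apply]
    rw [e1, Fintype.sum_prod_type, dim_qudit]
    have e2 : ∀ x : ZMod p, ∑ y : ZMod p,
        (if i + j = 2 * y then ZMod.stdAddChar (x * (i - j)) else 0) *
        (if k + l = 2 * y then ZMod.stdAddChar (x * (k - l)) else 0) =
        if i + j = k + l then ZMod.stdAddChar (x * (i - j + (k - l))) else 0 := by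
      intro x
      rw [Finset.sum_eq_single (h * (i + j))]
      · rw [if_pos (by linear_combination (-(i + j)) * h2)]
        have : k + l = 2 * (h * (i + j)) ↔ i + j = k + l := by
          constructor <;> intro e
          · linear_combination -e - (i + j) * h2
          · linear_combination -e - (i + j) * h2
        simp only [this]
        split_ifs
        · rw [← AddChar.map_add_eq_mul]; congr 1; ring
        · simp
      · intro b _ hb
        rw [if_neg fun e => hb (by linear_combination (- b) * h2 + (-h) * e), zero_mul]
      · simp
    simp only [e2]
    by_cases hc : i + j = k + l
    · simp only [if_pos hc]
      rw [sum_stdAddChar_mul]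
      refine if_congr ?_ rfl rfl
      constructor
      · intro e
        have hil : i = l := by linear_combination h * (e + hc) - (i - l) * h2
        exact ⟨hil, by linear_combination hc - hil⟩
      · rintro ⟨rfl, rfl⟩; ring
    · simp only [if_neg hc, Finset.sum_const_zero]
      rw [if_neg]
      rintro ⟨rfl, rfl⟩
      exact hc (add_comm _ _)
  | tensor A B hA hB =>
    obtain ⟨i, i'⟩ := i
    obtain ⟨j, j'⟩ := j
    obtain ⟨k, k'⟩ := k
    obtain ⟨l, l'⟩ := l
    have e1 : ∀ (a : A.Phase) (b : B.Phase),
        phaseOp A a i j * phaseOp B b i' j' * (phaseOp A a k l * phaseOp B b k' l') =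
        (phaseOp A a i j * phaseOp A a k l) * (phaseOp B b i' j' * phaseOp B b k' l') :=
      fun a b => by ring
    simp only [phaseOp_tensor_apply, Fintype.sum_prod_type, e1,
      ← Finset.mul_sum, ← Finset.sum_mul, hA, hB, dim_tensor, Prod.mk.injEq]
    push_cast
    by_cases h1 : i = l <;> by_cases h2 : i' = l' <;> by_cases h3 : j = k <;>
      by_cases h4 : j' = k' <;> simp [h1, h2, h3, h4]

lemma phaseOp_trace (A : QSystem) (u : A.Phase) : (phaseOp A u).trace = 1 := by
  induction A with
  | unit =>
    simp only [Matrix.trace, Matrix.diag, phaseOp_unit_apply]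
    simp
  | qudit p hp ho =>
    have : NeZero p := ⟨hp.ne_zero⟩
    set h := (((p + 1) / 2 : ℕ) : ZMod p)
    have h2 : h * 2 = 1 := half_mul_two ho
    have e1 : (phaseOp (qudit p hp ho) u).trace =
        ∑ i : ZMod p, if i + i = 2 * u.2 then ZMod.stdAddChar (u.1 * (i - i)) else 0 :=
      Finset.sum_congr rfl fun i _ => by
        rw [Matrix.diag_apply, phaseOp_qudit_apply]
    rw [e1, Finset.sum_eq_single u.2]
    · rw [if_pos (by ring)]; simp
    · intro b _ hb
      exact if_neg fun e => hb (by linear_combination h * e - (b - u.2) * h2)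
    · simp
  | tensor A B hA hB =>
    rw [phaseOp_tensor, fintypeBasis_tensor]
    exact (trace_kronecker _ _).trans (by rw [hA, hB, one_mul])

open Classical in
lemma trace_phaseOp_mul_phaseOp (A : QSystem) (u v : A.Phase) :
    (phaseOp A u * phaseOp A v).trace = if u = v then (A.dim : ℂ) else 0 := by
  induction A with
  | unit =>
    have : unit.dim = 1 := rfl
    simp only [Matrix.trace, Matrix.diag, Matrix.mul_apply, phaseOp_unit_apply]
    simp [this]
  | qudit p hp ho =>
    have : NeZero p := ⟨hp.ne_zero⟩
    set h := (((p + 1) / 2 : ℕ) : ZMod p)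
    have h2 : h * 2 = 1 := half_mul_two ho
    obtain ⟨a, b⟩ := u
    obtain ⟨c, d⟩ := v
    have e1 : (phaseOp (qudit p hp ho) (a, b) * phaseOp (qudit p hp ho) (c, d)).trace =
        ∑ i : ZMod p, ∑ j : ZMod p,
          (if i + j = 2 * b then ZMod.stdAddChar (a * (i - j)) else 0) *
          (if j + i = 2 * d then ZMod.stdAddChar (c * (j - i)) else 0) :=
      Finset.sum_congr rfl fun i _ => Finset.sum_congr rfl fun j _ =>
        congrArg₂ (· * ·) (phaseOp_qudit_apply hp ho _ _ _) (phaseOp_qudit_apply hp ho _ _ _)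
    have e2 : ∀ i : ZMod p, ∑ j : ZMod p,
          (if i + j = 2 * b then ZMod.stdAddChar (a * (i - j)) else 0) *
          (if j + i = 2 * d then ZMod.stdAddChar (c * (j - i)) else 0) =
        if b = d then ZMod.stdAddChar ((i - b) * (2 * (a - c))) else 0 := by
      intro i
      rw [Finset.sum_eq_single (2 * b - i)]
      · rw [if_pos (by ring)]
        have : 2 * b - i + i = 2 * d ↔ b = d := by
          constructor <;> intro e
          · linear_combination h * e - (b - d) * h2
          · linear_combination 2 * e
        simp only [this]
        split_ifs
        · rw [← AddChar.map_add_eq_mul]; congr 1; ring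
        · simp
      · intro j _ hj
        rw [if_neg fun e => hj (by linear_combination e), zero_mul]
      · simp
    rw [e1]
    simp only [e2, dim_qudit, Prod.mk.injEq]
    by_cases hbd : b = d
    · simp only [hbd, if_true, and_true]
      rw [← Equiv.sum_comp (Equiv.addRight d)]
      simp only [Equiv.coe_addRight, add_sub_cancel_right]
      rw [sum_stdAddChar_mul]
      refine if_congr ?_ rfl rfl
      constructor <;> intro e
      · linear_combination h * e - (a - c) * h2
      · linear_combination 2 * e
    · simp [hbd]
  | tensor A B hA hB =>
    rw [phaseOp_tensor, phaseOp_tensor, fintypeBasis_tensor]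
    refine (congrArg Matrix.trace (mul_kronecker_mul _ _ _ _).symm).trans ?_
    refine (trace_kronecker _ _).trans ?_
    rw [hA, hB, dim_tensor]
    obtain ⟨a, b⟩ := u
    obtain ⟨c, d⟩ := v
    push_cast
    by_cases h1 : a = c <;> by_cases h2 : b = d <;> simp [h1, h2]

/-! ### The Wigner representation -/

lemma wigner_apply {A : QSystem} (X : Op A) (u : A.Phase) :
    wigner X u = (1 / (A.dim : ℂ)) * ∑ i, ∑ j, phaseOp A u i j * X j i := rfl

lemma wigner_smul {A : QSystem} (c : ℂ) (X : Op A) (u : A.Phase) :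
    wigner (c • X) u = c * wigner X u := by
  simp only [wigner, Matrix.mul_smul, trace_smul, smul_eq_mul]
  ring

lemma wigner_sum {A : QSystem} {ι : Type*} (s : Finset ι) (X : ι → Op A) (u : A.Phase) :
    wigner (∑ k ∈ s, X k) u = ∑ k ∈ s, wigner (X k) u := by
  simp only [wigner, Finset.mul_sum, trace_sum]

lemma sum_wigner_smul_phaseOp {A : QSystem} (X : Op A) :
    ∑ u, wigner X u • phaseOp A u = X := by
  ext k l
  have h1 : (∑ u, wigner X u • phaseOp A u) k l =
      (1 / (A.dim : ℂ)) * ∑ i, ∑ j, X j i * ∑ u, phaseOp A u i j * phaseOp A u k l := by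
    simp only [Matrix.sum_apply, Matrix.smul_apply, wigner_apply, smul_eq_mul, Finset.mul_sum,
      Finset.sum_mul]
    rw [Finset.sum_comm]
    refine Finset.sum_congr rfl fun i _ => ?_
    rw [Finset.sum_comm]
    exact Finset.sum_congr rfl fun j _ => Finset.sum_congr rfl fun u _ => by ring
  have hd := A.dim_ne_zero
  rw [h1]
  simp only [sum_phaseOp_mul_phaseOp, ite_and]
  simp
  field_simp

lemma sum_wigner {A : QSystem} (X : Op A) : ∑ u, wigner X u = X.trace := by
  conv_rhs => rw [← sum_wigner_smul_phaseOp X]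
  simp [trace_sum, trace_smul, phaseOp_trace]

open Classical in
lemma wigner_phaseOp {A : QSystem} (u v : A.Phase) :
    wigner (phaseOp A u) v = if v = u then 1 else 0 := by
  rw [wigner, trace_phaseOp_mul_phaseOp]
  split_ifs
  · exact one_div_mul_cancel A.dim_ne_zero
  · simp

lemma wignerTraceNorm_phaseOp {A : QSystem} (u : A.Phase) :
    wignerTraceNorm (phaseOp A u) = 1 := by
  classical
  rw [wignerTraceNorm, Finset.sum_eq_single u]
  · simp [wigner_phaseOp]
  · intro v _ hv
    simp [wigner_phaseOp, hv]
  · simp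

/-- An ℓ¹ → ℓ¹ operator norm is attained on basis vectors, here the `A_u`. -/
lemma wignerTraceNorm_map_le {A B : QSystem} (N : Op A →ₗ[ℂ] Op B)
    (h : ∀ u, wignerTraceNorm (N (phaseOp A u)) ≤ 1) (X : Op A) :
    wignerTraceNorm (N X) ≤ wignerTraceNorm X := by
  have e : ∀ v, wigner (N X) v = ∑ u, wigner X u * wigner (N (phaseOp A u)) v := by
    intro v
    conv_lhs => rw [← sum_wigner_smul_phaseOp X]
    simp only [map_sum, map_smul, wigner_sum, wigner_smul]
  calc wignerTraceNorm (N X) = ∑ v, ‖∑ u, wigner X u * wigner (N (phaseOp A u)) v‖ₑ := by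
        simp only [wignerTraceNorm, e]
    _ ≤ ∑ v, ∑ u, ‖wigner X u‖ₑ * ‖wigner (N (phaseOp A u)) v‖ₑ := by
        refine Finset.sum_le_sum fun v _ => (enorm_sum_le _ _).trans ?_
        exact Finset.sum_le_sum fun u _ => (enorm_mul _ _).le
    _ = ∑ u, ‖wigner X u‖ₑ * wignerTraceNorm (N (phaseOp A u)) := by
        rw [Finset.sum_comm]
        simp only [wignerTraceNorm, Finset.mul_sum]
    _ ≤ ∑ u, ‖wigner X u‖ₑ * 1 := by gcongr with u; exact h u
    _ = wignerTraceNorm X := by simp only [mul_one]; rfl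

lemma trace_phaseOp_mul_kronecker {A B : QSystem} (M : Op A) (M' : Op B)
    (u : (tensor A B).Phase) : (phaseOp (tensor A B) u * kronecker M M').trace =
      (phaseOp A u.1 * M).trace * (phaseOp B u.2 * M').trace := by
  rw [phaseOp_tensor]
  refine (congrArg Matrix.trace (mul_kronecker_mul _ _ _ _).symm).trans ?_
  exact trace_kronecker _ _

lemma wigner_kronecker {A B : QSystem} (M : Op A) (M' : Op B) (u : (tensor A B).Phase) :
    wigner (A := tensor A B) (kronecker M M') u = wigner M u.1 * wigner M' u.2 := by
  rw [wigner, trace_phaseOp_mul_kronecker, dim_tensor, wigner, wigner]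
  push_cast
  have hA := A.dim_ne_zero
  have hB := B.dim_ne_zero
  field_simp

lemma wignerTraceNorm_kronecker {A B : QSystem} (M : Op A) (M' : Op B) :
    wignerTraceNorm (A := tensor A B) (kronecker M M') =
      wignerTraceNorm M * wignerTraceNorm M' := by
  simp only [wignerTraceNorm, wigner_kronecker, Fintype.sum_prod_type, enorm_mul,
    ← Finset.mul_sum, ← Finset.sum_mul]

/-! ### Extensions of linear maps and complete positivity -/

/-- `id_R ⊗ N` as a linear map. -/
def idTensorLinear (r : Type*) {a b : Type*} (N : Matrix a a ℂ →ₗ[ℂ] Matrix b b ℂ) :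
    Matrix (r × a) (r × a) ℂ →ₗ[ℂ] Matrix (r × b) (r × b) ℂ where
  toFun := idTensor N
  map_add' X Y := by
    ext x y
    exact congrFun₂ (N.map_add (Matrix.of fun i j => X (x.1, i) (y.1, j))
      (Matrix.of fun i j => Y (x.1, i) (y.1, j))) x.2 y.2
  map_smul' c X := by
    ext x y
    exact congrFun₂ (N.map_smul c (Matrix.of fun i j => X (x.1, i) (y.1, j))) x.2 y.2

lemma idTensorLinear_apply {r a b : Type*} (N : Matrix a a ℂ →ₗ[ℂ] Matrix b b ℂ)
    (X : Matrix (r × a) (r × a) ℂ) : idTensorLinear r N X = idTensor N X := rfl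

lemma idTensor_kronecker {r a b : Type*} (N : Matrix a a ℂ →ₗ[ℂ] Matrix b b ℂ)
    (M : Matrix r r ℂ) (M' : Matrix a a ℂ) :
    idTensor N (kronecker M M') = kronecker M (N M') := by
  ext x y
  have : (Matrix.of fun i j => kronecker M M' (x.1, i) (y.1, j)) = M x.1 y.1 • M' := rfl
  simp only [idTensor, Matrix.of_apply, this, map_smul]
  rfl

lemma idTensor_submatrix {r s a b : Type*} (N : Matrix a a ℂ →ₗ[ℂ] Matrix b b ℂ) (f : s → r)
    (X : Matrix (r × a) (r × a) ℂ) :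
    idTensor N (X.submatrix (Prod.map f id) (Prod.map f id)) =
      (idTensor N X).submatrix (Prod.map f id) (Prod.map f id) := rfl

lemma idTensor_sub_smul {r a b : Type*} (N E : Matrix a a ℂ →ₗ[ℂ] Matrix b b ℂ) (c : ℂ)
    (X : Matrix (r × a) (r × a) ℂ) :
    idTensor (c • E - N) X = c • idTensor E X - idTensor N X := rfl

lemma IsCP.idTensor_posSemidef {A B : QSystem} {N : Op A →ₗ[ℂ] Op B} (hN : IsCP N)
    {r : Type*} [Fintype r] {X : Matrix (r × A.Basis) (r × A.Basis) ℂ} (hX : X.PosSemidef) :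
    (idTensor N X).PosSemidef := by
  let e := Fintype.equivFin r
  have h := hN (Fintype.card r) _ (hX.submatrix (Prod.map e.symm id))
  rw [idTensor_submatrix] at h
  have h' := h.submatrix (Prod.map e id)
  rw [Matrix.submatrix_submatrix] at h'
  have e1 : Prod.map e.symm id ∘ Prod.map e id = (id : r × B.Basis → r × B.Basis) := by
    ext x <;> simp
  simpa only [e1, Matrix.submatrix_id_id] using h'

lemma IsCP.map_posSemidef {A B : QSystem} {N : Op A →ₗ[ℂ] Op B} (hN : IsCP N)
    {X : Op A} (hX : X.PosSemidef) : (N X).PosSemidef := by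
  have h := hN.idTensor_posSemidef (r := Unit) (hX.submatrix (Prod.snd : Unit × A.Basis → A.Basis))
  exact h.submatrix (fun b => ((), b))

/-- The Choi matrix. -/
def choi {A B : QSystem} (D : Op A →ₗ[ℂ] Op B) :
    Matrix (A.Basis × B.Basis) (A.Basis × B.Basis) ℂ :=
  Matrix.of fun x y => D (Matrix.single x.1 y.1 1) x.2 y.2

lemma map_apply_eq_sum_choi {A B : QSystem} (D : Op A →ₗ[ℂ] Op B) (X : Op A) (b b' : B.Basis) :
    D X b b' = ∑ i, ∑ j, X i j * choi D (i, b) (j, b') := by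
  conv_lhs => rw [Matrix.matrix_eq_sum_single X]
  simp only [map_sum, Matrix.sum_apply, choi, Matrix.of_apply]
  refine Finset.sum_congr rfl fun i _ => Finset.sum_congr rfl fun j _ => ?_
  have : Matrix.single i j (X i j) = X i j • Matrix.single i j (1 : ℂ) := by
    rw [Matrix.smul_single, smul_eq_mul, mul_one]
  rw [this, map_smul]; rfl

/-- Choi's criterion: each column of a factor `C` of `X = C C†` is obtained from the maximally
entangled vector by an operator on the reference side, so `id ⊗ D` of `X` is a sum of conjugates of
the Choi matrix. -/
lemma isCP_of_choi_posSemidef {A B : QSystem} {D : Op A →ₗ[ℂ] Op B} (h : (choi D).PosSemidef) :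
    IsCP D := by
  intro m X hX
  obtain ⟨C, rfl⟩ : ∃ C : Matrix (Fin m × A.Basis) (Fin m × A.Basis) ℂ, X = C * Cᴴ := by
    open scoped MatrixOrder Matrix.Norms.L2Operator in
    exact CStarAlgebra.nonneg_iff_eq_mul_star_self.mp hX.nonneg
  let K : Fin m × A.Basis → Matrix (Fin m × B.Basis) (A.Basis × B.Basis) ℂ := fun k =>
    Matrix.of fun x y => if x.2 = y.2 then C (x.1, y.1) k else 0
  have e : idTensor D (C * Cᴴ) = ∑ k, K k * choi D * (K k)ᴴ := by
    ext x y
    have hK : ∀ k, (K k * choi D * (K k)ᴴ) x y =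
        ∑ i, ∑ j, C (x.1, i) k * star (C (y.1, j) k) * choi D (i, x.2) (j, y.2) := by
      intro k
      simp only [Matrix.mul_apply, K, Matrix.of_apply, conjTranspose_apply,
        Fintype.sum_prod_type]
      simp only [ite_mul, zero_mul, Finset.sum_ite_eq, Finset.mem_univ, if_true, apply_ite star,
        star_zero, mul_ite, mul_zero]
      rw [Finset.sum_comm]
      simp only [Finset.sum_mul]
      exact Finset.sum_congr rfl fun i _ => Finset.sum_congr rfl fun j _ => by ring
    simp only [idTensor, Matrix.of_apply, Matrix.sum_apply, hK]
    rw [map_apply_eq_sum_choi]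
    simp only [Matrix.of_apply, Matrix.mul_apply, conjTranspose_apply, Finset.sum_mul]
    rw [Finset.sum_comm]
    conv_rhs => rw [Finset.sum_comm]
    rw [Finset.sum_comm]
    exact Finset.sum_congr rfl fun i _ => Finset.sum_comm
  rw [e]
  exact posSemidef_sum _ fun k _ => h.mul_mul_conjTranspose_same (K k)

/-- The maximally entangled vector of `A ⊗ A`, not normalized. -/
def omegaVec (A : QSystem) : A.Basis × A.Basis → ℂ := fun x => if x.1 = x.2 then 1 else 0

lemma idTensor_omegaVec {A B : QSystem} (D : Op A →ₗ[ℂ] Op B) :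
    idTensor D (vecMulVec (omegaVec A) (star (omegaVec A))) = choi D := by
  ext x y
  have : (Matrix.of fun i j => vecMulVec (omegaVec A) (star (omegaVec A)) (x.1, i) (y.1, j)) =
      Matrix.single x.1 y.1 (1 : ℂ) := by
    ext i j
    simp only [vecMulVec, Matrix.of_apply, omegaVec, Pi.star_apply, Matrix.single_apply]
    by_cases h1 : x.1 = i <;> by_cases h2 : y.1 = j <;> simp [h1, h2]
  exact congrArg (fun M => D M x.2 y.2) this

/-! ### Wigner trace norm compared with the trace -/

lemma enorm_trace_le_wignerTraceNorm {A : QSystem} (X : Op A) :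
    ‖X.trace‖ₑ ≤ wignerTraceNorm X := by
  rw [← sum_wigner]
  exact enorm_sum_le _ _

lemma wignerTraceNorm_of_nonneg {A : QSystem} {X : Op A} (h : ∀ u, 0 ≤ wigner X u) :
    wignerTraceNorm X = ‖X.trace‖ₑ := by
  have h1 : ∀ u, wigner X u = ((wigner X u).re : ℂ) := fun u =>
    Complex.ext rfl (Complex.nonneg_iff.mp (h u)).2.symm
  have h2 : ∀ u, 0 ≤ (wigner X u).re := fun u => (Complex.nonneg_iff.mp (h u)).1
  have h3 : ∀ u, ‖wigner X u‖ₑ = ENNReal.ofReal (wigner X u).re := fun u => by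
    rw [h1 u, ← ofReal_norm, Complex.norm_real, Real.norm_of_nonneg (h2 u), Complex.ofReal_re]
  have h4 : X.trace = ((∑ u, (wigner X u).re : ℝ) : ℂ) := by
    rw [← sum_wigner, Complex.ofReal_sum]
    exact Finset.sum_congr rfl fun u _ => h1 u
  rw [h4, ← ofReal_norm, Complex.norm_real, Real.norm_of_nonneg (Finset.sum_nonneg fun u _ => h2 u),
    ENNReal.ofReal_sum_of_nonneg fun u _ => h2 u]
  exact Finset.sum_congr rfl fun u _ => h3 u

lemma wignerTraceNorm_one (A : QSystem) : wignerTraceNorm (1 : Op A) = (A.dim : ℝ≥0∞) := by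
  rw [wignerTraceNorm_of_nonneg]
  · rw [Matrix.trace_one]
    rw [← ofReal_norm, Complex.norm_natCast, ENNReal.ofReal_natCast]
    rfl
  · intro u
    rw [wigner, mul_one, phaseOp_trace, mul_one, one_div, inv_nonneg]
    exact Nat.cast_nonneg _

/-! ### Maps with non-positive mana -/

lemma log2_le_zero_iff {x : ℝ≥0∞} : log2 x ≤ 0 ↔ x ≤ 1 := by
  have h : (0 : EReal) < ((Real.log 2 : ℝ) : EReal) :=
    EReal.coe_pos.mpr (Real.log_pos one_lt_two)
  rw [log2, EReal.div_le_iff_le_mul h (EReal.coe_ne_top _), mul_zero, ENNReal.log_le_zero_iff]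

lemma wignerTraceNorm_le_one_of_mana {A B : QSystem} {E : Op A →ₗ[ℂ] Op B} (hE : mana E ≤ 0)
    (u : A.Phase) : wignerTraceNorm (E (phaseOp A u)) ≤ 1 :=
  (le_iSup (fun u => wignerTraceNorm (E (phaseOp A u))) u).trans (log2_le_zero_iff.mp hE)

/-- Point operators of `RA` are products, and the reference factor has norm 1, so a reference system
costs nothing. -/
lemma wignerTraceNorm_idTensor_le {R A B : QSystem} {E : Op A →ₗ[ℂ] Op B}
    (hE : ∀ u, wignerTraceNorm (E (phaseOp A u)) ≤ 1) (X : Op (tensor R A)) :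
    wignerTraceNorm (A := tensor R B) (idTensor E X) ≤ wignerTraceNorm X := by
  refine wignerTraceNorm_map_le (A := tensor R A) (B := tensor R B)
    (idTensorLinear R.Basis E) (fun u => ?_) X
  rw [idTensorLinear_apply, phaseOp_tensor, idTensor_kronecker, wignerTraceNorm_kronecker,
    wignerTraceNorm_phaseOp, one_mul]
  exact hE _

/-! ### CPWP channels -/

/-- The maximally entangled state. -/
noncomputable def maxEntangled (A : QSystem) : Op (tensor A A) :=
  (1 / (A.dim : ℂ)) • vecMulVec (omegaVec A) (star (omegaVec A))

lemma maxEntangled_apply (A : QSystem) (x y : A.Basis × A.Basis) :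
    maxEntangled A x y =
      (1 / (A.dim : ℂ)) * if x.1 = x.2 then (if y.1 = y.2 then 1 else 0) else 0 := by
  simp only [maxEntangled, Matrix.smul_apply, vecMulVec_apply, omegaVec, Pi.star_apply,
    apply_ite star, star_one, star_zero, smul_eq_mul, ite_mul, one_mul, zero_mul]

lemma wigner_maxEntangled (A : QSystem) (u : (tensor A A).Phase) :
    wigner (maxEntangled A) u =
      (1 / (A.dim : ℂ)) ^ 3 * (phaseOp A u.1 * (phaseOp A u.2)ᵀ).trace := by
  simp only [wigner_apply, maxEntangled_apply, phaseOp_tensor_apply, Fintype.sum_prod_type,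
    dim_tensor]
  simp only [mul_ite, mul_one, mul_zero, Finset.sum_ite_eq, Finset.mem_univ, if_true,
    Finset.sum_const_zero, Finset.sum_ite_irrel]
  simp only [Matrix.trace, Matrix.diag, Matrix.mul_apply, transpose_apply, Finset.mul_sum]
  push_cast
  exact Finset.sum_congr rfl fun i _ => Finset.sum_congr rfl fun j _ => by ring

lemma maxEntangled_mem_wignerPolytope (A : QSystem) :
    maxEntangled A ∈ wignerPolytope (tensor A A) := by
  have hd : (0 : ℂ) ≤ 1 / (A.dim : ℂ) := by
    rw [one_div, inv_nonneg]; exact Nat.cast_nonneg _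
  refine ⟨⟨(posSemidef_vecMulVec_self_star _).smul hd, ?_⟩, fun u => ?_⟩
  · have : (maxEntangled A).trace = ∑ x : A.Basis × A.Basis, maxEntangled A x x := rfl
    rw [this]
    simp only [maxEntangled_apply, Fintype.sum_prod_type]
    simp only [mul_ite, mul_one, mul_zero, Finset.sum_ite_eq, Finset.mem_univ, if_true]
    rw [Finset.sum_const, Finset.card_univ, nsmul_eq_mul]
    exact mul_one_div_cancel A.dim_ne_zero
  · classical
    obtain ⟨v, hv⟩ := exists_phaseOp_transpose A u.2
    rw [wigner_maxEntangled, hv, trace_phaseOp_mul_phaseOp]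
    refine mul_nonneg (pow_nonneg hd 3) ?_
    split_ifs
    · exact Nat.cast_nonneg _
    · exact le_rfl

lemma idTensor_maxEntangled {A B : QSystem} (D : Op A →ₗ[ℂ] Op B) :
    idTensor D (maxEntangled A) = (1 / (A.dim : ℂ)) • choi D := by
  rw [← idTensor_omegaVec]
  exact (idTensorLinear A.Basis D).map_smul _ _

/-- Pairing the reference half of the maximally entangled state with `A_u` feeds the transpose of
`A_u` into the map. -/
lemma wigner_idTensor_maxEntangled {A B : QSystem} (D : Op A →ₗ[ℂ] Op B)
    (u : A.Phase) (v : B.Phase) :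
    wigner (A := tensor A B) (idTensor D (maxEntangled A)) (u, v) =
      (1 / (A.dim : ℂ)) ^ 2 * wigner (D (phaseOp A u)ᵀ) v := by
  rw [idTensor_maxEntangled, wigner_smul]
  simp only [wigner_apply, phaseOp_tensor_apply, Fintype.sum_prod_type, dim_tensor,
    map_apply_eq_sum_choi, transpose_apply, Finset.mul_sum]
  push_cast
  rw [Finset.sum_comm]
  refine Finset.sum_congr rfl fun b _ => ?_
  have : ∀ i : A.Basis, ∑ j : A.Basis, ∑ b' : B.Basis, 1 / (A.dim : ℂ) *
      (1 / ((A.dim : ℂ) * (B.dim : ℂ)) * (phaseOp A u i j * phaseOp B v b b' *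
        choi D (j, b') (i, b))) = ∑ b' : B.Basis, ∑ j : A.Basis, 1 / (A.dim : ℂ) *
      (1 / ((A.dim : ℂ) * (B.dim : ℂ)) * (phaseOp A u i j * phaseOp B v b b' *
        choi D (j, b') (i, b))) := fun i => Finset.sum_comm
  simp only [this]
  rw [Finset.sum_comm]
  refine Finset.sum_congr rfl fun b' _ => ?_
  rw [Finset.sum_comm]
  refine Finset.sum_congr rfl fun i _ => Finset.sum_congr rfl fun j _ => ?_
  rw [one_div_mul_eq_div]
  ring

/-- The maximally entangled state is free, so its image under `id ⊗ F` is free; hence every `F(A_u)`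
has a nonnegative Wigner function. Its norm is then its trace, which is 1. -/
lemma IsCPWPChannel.wignerTraceNorm_le {A B : QSystem} {F : Op A →ₗ[ℂ] Op B}
    (hF : IsCPWPChannel F) (X : Op A) : wignerTraceNorm (F X) ≤ wignerTraceNorm X := by
  refine wignerTraceNorm_map_le F (fun u => ?_) X
  have h : ∀ v, 0 ≤ wigner (F (phaseOp A u)) v := by
    intro v
    obtain ⟨w, hw⟩ := exists_phaseOp_transpose A u
    have h1 := (hF.2 A _ (maxEntangled_mem_wignerPolytope A)).2 (w, v)
    rw [wigner_idTensor_maxEntangled, ← hw, transpose_transpose] at h1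
    have hd : (0 : ℂ) < (1 / (A.dim : ℂ)) ^ 2 := by
      have : (0 : ℂ) < A.dim := Nat.cast_pos.mpr A.dim_pos
      positivity
    exact le_of_mul_le_mul_left (by rwa [mul_zero]) hd
  rw [wignerTraceNorm_of_nonneg h, hF.1.2, phaseOp_trace]
  simp

/-! ### The max-divergence -/

/-- Among the pure states in the supremum, the maximally entangled one suffices: an operator
inequality there is positivity of a Choi matrix. The strict bound avoids asking whether the infimum
in `dMax` is attained. -/
lemma exists_isCP_of_dMaxMap_lt {A B : QSystem} {N E : Op A →ₗ[ℂ] Op B} {c : EReal}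
    (h : dMaxMap N E < c) :
    ∃ l : ℝ, (l : EReal) < c ∧ IsCP ((((2 : ℝ) ^ l : ℝ) : ℂ) • E - N) := by
  let ψ : (tensor A A).Basis → ℂ := fun x => ((1 / Real.sqrt A.dim : ℝ) : ℂ) * omegaVec A x
  have hd : (0 : ℝ) < A.dim := Nat.cast_pos.mpr A.dim_pos
  have hψ : ∑ x, ‖ψ x‖ ^ 2 = 1 := by
    have h1 : ∀ x, ‖ψ x‖ ^ 2 = if x.1 = x.2 then 1 / (A.dim : ℝ) else 0 := by
      intro x
      simp only [ψ, omegaVec]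
      split_ifs
      · rw [mul_one, Complex.norm_real, Real.norm_eq_abs, sq_abs, div_pow, one_pow,
          Real.sq_sqrt hd.le]
      · simp
    simp only [h1, Fintype.sum_prod_type, Finset.sum_ite_eq, Finset.mem_univ, if_true]
    rw [Finset.sum_const, Finset.card_univ, nsmul_eq_mul]
    exact mul_one_div_cancel hd.ne'
  have hψ2 : vecMulVec ψ (star ψ) = maxEntangled A := by
    ext x y
    have h2 : ((1 / Real.sqrt A.dim : ℝ) : ℂ) * ((1 / Real.sqrt A.dim : ℝ) : ℂ) =
        1 / (A.dim : ℂ) := by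
      rw [← Complex.ofReal_mul, ← pow_two, div_pow, one_pow, Real.sq_sqrt hd.le]
      simp
    simp only [maxEntangled, Matrix.smul_apply, vecMulVec_apply, ψ, Pi.star_apply, smul_eq_mul,
      star_mul', ← h2]
    rw [Complex.star_def, Complex.conj_ofReal]
    ring
  have h1 := (le_iSup (fun ψ : {ψ : (tensor A A).Basis → ℂ // ∑ x, ‖ψ x‖ ^ 2 = 1} =>
    dMax (A := tensor A B) (idTensor N (vecMulVec ψ.1 (star ψ.1)))
      (idTensor E (vecMulVec ψ.1 (star ψ.1)))) ⟨ψ, hψ⟩).trans_lt h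
  simp only [hψ2, dMax] at h1
  obtain ⟨_, ⟨l, hl, rfl⟩, hlc⟩ := sInf_lt_iff.mp h1
  refine ⟨l, hlc, isCP_of_choi_posSemidef ?_⟩
  have hl' : ((((2 : ℝ) ^ l : ℝ) : ℂ) • idTensor E (maxEntangled A) -
      idTensor N (maxEntangled A)).PosSemidef := hl
  rw [← idTensor_sub_smul, idTensor_maxEntangled] at hl'
  have hd' : (0 : ℂ) ≤ A.dim := Nat.cast_nonneg _
  have := hl'.smul hd'
  rwa [smul_smul, mul_one_div_cancel A.dim_ne_zero, one_smul] at this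

/-- Test on the identity: `N` gives trace `d`, while the trace of `E 1` has modulus at most its
Wigner trace norm, hence at most `d`. So `2^l d ≥ d`. This excludes the value `⊥` for `maxThauma`.
-/
lemma exponent_nonneg_of_isCP {A B : QSystem} {N E : Op A →ₗ[ℂ] Op B} (hN : IsChannel N)
    (hE : mana E ≤ 0) {l : ℝ} (h : IsCP ((((2 : ℝ) ^ l : ℝ) : ℂ) • E - N)) : 0 ≤ l := by
  have hd : (0 : ℝ) < A.dim := Nat.cast_pos.mpr A.dim_pos
  have h1 := (h.map_posSemidef (Matrix.PosSemidef.one (n := A.Basis) (R := ℂ))).trace_nonneg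
  have h2 : (N 1).trace = A.dim := (hN.2 1).trans Matrix.trace_one
  rw [LinearMap.sub_apply, LinearMap.smul_apply, trace_sub, trace_smul, h2, smul_eq_mul] at h1
  have h3 := (Complex.nonneg_iff.mp h1).1
  rw [Complex.sub_re, Complex.re_ofReal_mul, Complex.natCast_re] at h3
  have h4 : ‖(E 1).trace‖ₑ ≤ A.dim :=
    (enorm_trace_le_wignerTraceNorm _).trans
      ((wignerTraceNorm_map_le E (wignerTraceNorm_le_one_of_mana hE) 1).trans
        (wignerTraceNorm_one A).le)
  have h5 : ‖(E 1).trace‖ ≤ A.dim := by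
    rw [← ofReal_norm, ← ENNReal.ofReal_natCast] at h4
    exact (ENNReal.ofReal_le_ofReal_iff hd.le).mp h4
  have h6 : (E 1).trace.re ≤ A.dim := (Complex.re_le_norm _).trans h5
  by_contra hl
  have h7 : (2 : ℝ) ^ l < 1 := Real.rpow_lt_one_of_one_lt_of_neg one_lt_two (not_le.mp hl)
  have h8 : (0 : ℝ) < (2 : ℝ) ^ l := Real.rpow_pos_of_pos two_pos l
  nlinarith

lemma maxThauma_nonneg {A B : QSystem} {N : Op A →ₗ[ℂ] Op B} (hN : IsChannel N) :
    0 ≤ maxThauma N := by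
  refine le_iInf fun E => ?_
  by_contra h
  obtain ⟨l, hl, hcp⟩ := exists_isCP_of_dMaxMap_lt (not_le.mp h)
  exact absurd (exponent_nonneg_of_isCP hN E.2.2 hcp) (not_le.mpr (EReal.coe_neg'.mp hl))

/-! ### Replacing the channel in a protocol -/

namespace DistProtocol

variable {A B S : QSystem} {n : ℕ} (P : DistProtocol A B S n)

lemma state_posSemidef {N : Op A →ₗ[ℂ] Op B} (hN : IsCP N) {i : ℕ} (hi : i < n) :
    (P.state N i).PosSemidef := by
  induction i with
  | zero => exact P.prep_free.1.1.map_posSemidef Matrix.PosSemidef.one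
  | succ i ih =>
    exact (P.mid_free i hi).1.1.map_posSemidef (hN.idTensor_posSemidef (ih (by omega)))

lemma output_posSemidef {N : Op A →ₗ[ℂ] Op B} (hN : IsCP N) : (P.output N).PosSemidef :=
  P.final_free.1.1.map_posSemidef
    (hN.idTensor_posSemidef (P.state_posSemidef hN (Nat.sub_lt P.pos Nat.one_pos)))

lemma wignerTraceNorm_state_le {E : Op A →ₗ[ℂ] Op B} (hE : mana E ≤ 0) {i : ℕ} (hi : i < n) :
    wignerTraceNorm (P.state E i) ≤ 1 := by
  induction i with
  | zero =>
    refine (P.prep_free.wignerTraceNorm_le _).trans ?_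
    rw [wignerTraceNorm_one]
    exact Nat.cast_one.le
  | succ i ih =>
    exact ((P.mid_free i hi).wignerTraceNorm_le _).trans
      ((wignerTraceNorm_idTensor_le (wignerTraceNorm_le_one_of_mana hE) _).trans (ih (by omega)))

lemma wignerTraceNorm_output_le {E : Op A →ₗ[ℂ] Op B} (hE : mana E ≤ 0) :
    wignerTraceNorm (P.output E) ≤ 1 :=
  (P.final_free.wignerTraceNorm_le _).trans
    ((wignerTraceNorm_idTensor_le (wignerTraceNorm_le_one_of_mana hE) _).trans
      (P.wignerTraceNorm_state_le hE (Nat.sub_lt P.pos Nat.one_pos)))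

/-- One use of the channel costs one factor `c`: `c a E(Y) - N(X) = c E(aY - X) + (cE - N)(X)`, with
both maps extended by the identity. -/
lemma idTensor_smul_sub_posSemidef {r : Type*} [Fintype r] {N E : Op A →ₗ[ℂ] Op B} {c a : ℝ}
    (hc : 0 ≤ c) (hE : IsCP E) (h : IsCP ((c : ℂ) • E - N))
    {X Y : Matrix (r × A.Basis) (r × A.Basis) ℂ} (hX : X.PosSemidef)
    (hXY : ((a : ℂ) • Y - X).PosSemidef) :
    (((c * a : ℝ) : ℂ) • idTensor E Y - idTensor N X).PosSemidef := by
  have h1 := (hE.idTensor_posSemidef hXY).smul (Complex.zero_le_real.mpr hc)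
  have h2 := h.idTensor_posSemidef hX
  have e : ((c * a : ℝ) : ℂ) • idTensor E Y - idTensor N X =
      (c : ℂ) • idTensor E ((a : ℂ) • Y - X) + idTensor ((c : ℂ) • E - N) X := by
    have e1 : idTensor E ((a : ℂ) • Y - X) = (a : ℂ) • idTensor E Y - idTensor E X := by
      simp only [← idTensorLinear_apply, map_sub, map_smul]
    rw [idTensor_sub_smul, e1, smul_sub, smul_smul]
    push_cast
    abel
  rw [e]
  exact h1.add h2

lemma smul_state_sub_posSemidef {N E : Op A →ₗ[ℂ] Op B} (hN : IsCP N) (hE : IsCP E) {c : ℝ}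
    (hc : 0 ≤ c) (h : IsCP ((c : ℂ) • E - N)) {i : ℕ} (hi : i < n) :
    (((c ^ i : ℝ) : ℂ) • P.state E i - P.state N i).PosSemidef := by
  induction i with
  | zero =>
    have : ((c ^ 0 : ℝ) : ℂ) • P.state E 0 - P.state N 0 = 0 := by
      rw [pow_zero, Complex.ofReal_one, one_smul]
      exact sub_self _
    rw [this]
    exact Matrix.PosSemidef.zero
  | succ i ih =>
    have h1 := idTensor_smul_sub_posSemidef hc hE h (P.state_posSemidef hN (by omega))
      (ih (by omega))
    have h2 := (P.mid_free i hi).1.1.map_posSemidef h1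
    rw [← pow_succ'] at h2
    rwa [map_sub, map_smul] at h2

lemma smul_output_sub_posSemidef {N E : Op A →ₗ[ℂ] Op B} (hN : IsCP N) (hE : IsCP E) {c : ℝ}
    (hc : 0 ≤ c) (h : IsCP ((c : ℂ) • E - N)) :
    (((c ^ n : ℝ) : ℂ) • P.output E - P.output N).PosSemidef := by
  have hn : n - 1 < n := Nat.sub_lt P.pos Nat.one_pos
  have h1 := idTensor_smul_sub_posSemidef hc hE h (P.state_posSemidef hN hn)
      (P.smul_state_sub_posSemidef hN hE hc h hn)
  have h2 := P.final_free.1.1.map_posSemidef h1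
  rw [← pow_succ', Nat.sub_add_cancel P.pos] at h2
  rwa [map_sub, map_smul] at h2

end DistProtocol

/-! ### A witness for the `T` state -/

lemma xi_pow (k : ℕ) : xi ^ k = Complex.exp (2 * Real.pi * Complex.I * k / 9) := by
  rw [xi, ← Complex.exp_nat_mul]; congr 1; ring

lemma xi_pow_nine : xi ^ 9 = 1 := by
  rw [xi_pow, ← Complex.exp_two_pi_mul_I]
  congr 1; push_cast; ring

lemma xi_pow_three_ne_one : xi ^ 3 ≠ 1 := by
  have h := Complex.isPrimitiveRoot_exp 9 (by norm_num)
  exact h.pow_ne_one_of_pos_of_lt (by norm_num) (by norm_num)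

lemma xi_cyclotomic : xi ^ 6 + xi ^ 3 + 1 = 0 := by
  have h : (xi ^ 3 - 1) * (xi ^ 6 + xi ^ 3 + 1) = 0 := by linear_combination xi_pow_nine
  exact (mul_eq_zero.mp h).resolve_left (sub_ne_zero.mpr xi_pow_three_ne_one)

lemma xi_inv : xi⁻¹ = xi ^ 8 :=
  inv_eq_of_mul_eq_one_right (by linear_combination xi_pow_nine)

lemma star_xi : star xi = xi ^ 8 := by
  rw [← xi_inv, xi, ← Complex.exp_neg, Complex.star_def, ← Complex.exp_conj]
  congr 1
  rw [map_div₀, map_mul, map_mul, Complex.conj_I, Complex.conj_ofReal, Complex.conj_ofNat,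
    Complex.conj_ofNat]
  ring

lemma two_sin_eq_xi : ((2 * Real.sin (Real.pi / 18) : ℝ) : ℂ) = xi ^ 2 + xi ^ 7 := by
  have h1 : Real.sin (Real.pi / 18) = Real.cos (4 * Real.pi / 9) := by
    rw [← Real.cos_pi_div_two_sub]; congr 1; ring
  have h2 : xi ^ 7 = Complex.exp (-(2 * Real.pi * Complex.I * 2 / 9)) := by
    rw [xi_pow, ← mul_one (Complex.exp (-_)), ← Complex.exp_two_pi_mul_I, ← Complex.exp_add]
    congr 1; push_cast; ring
  rw [h1, h2, xi_pow]
  push_cast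
  rw [Complex.two_cos]
  congr 2 <;> ring

lemma stdAddChar_three (k : ZMod 3) : ZMod.stdAddChar k = xi ^ (3 * k.val) := by
  rw [ZMod.stdAddChar_apply, ZMod.toCircle_apply, xi_pow]
  congr 1; push_cast; ring

lemma stdAddChar_three_eq (k : Fin 3) :
    ZMod.stdAddChar (N := 3) k = (![1, xi ^ 3, xi ^ 6] : Fin 3 → ℂ) k := by
  refine (stdAddChar_three k).trans ?_
  fin_cases k
  · exact pow_zero _
  · rfl
  · rfl

lemma tVec_apply (i : Fin 3) :
    (tVec : Fin 3 → ℂ) i = ((1 / Real.sqrt 3 : ℝ) : ℂ) * (![xi, 1, xi ^ 8] : Fin 3 → ℂ) i := by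
  rw [← xi_inv, mul_comm]
  exact mulVec_diagonal _ _ _

/-- The `T` state, boosted. -/
noncomputable def tVecBoost : Fin 3 → ℂ := fun i =>
  (![1, xi ^ 6, xi ^ 3] : Fin 3 → ℂ) i * (tVec : Fin 3 → ℂ) i

lemma tVec_outer (i j : Fin 3) :
    3 * ((tVec : Fin 3 → ℂ) i * star ((tVec : Fin 3 → ℂ) j)) =
      (![xi, 1, xi ^ 8] : Fin 3 → ℂ) i * (![xi ^ 8, 1, xi] : Fin 3 → ℂ) j := by
  have h : 3 * (((1 / Real.sqrt 3 : ℝ) : ℂ) * ((1 / Real.sqrt 3 : ℝ) : ℂ)) = 1 := by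
    rw [← Complex.ofReal_mul, ← pow_two, div_pow, one_pow, Real.sq_sqrt (by norm_num)]
    push_cast; norm_num
  have hs : star ((![xi, 1, xi ^ 8] : Fin 3 → ℂ) j) = (![xi ^ 8, 1, xi] : Fin 3 → ℂ) j := by
    fin_cases j
    · exact star_xi
    · exact star_one _
    · change star (xi ^ 8) = xi
      rw [← star_xi, star_star]
  rw [tVec_apply, tVec_apply, star_mul', hs, Complex.star_def, Complex.conj_ofReal]
  linear_combination ((![xi, 1, xi ^ 8] : Fin 3 → ℂ) i * (![xi ^ 8, 1, xi] : Fin 3 → ℂ) j) * h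

lemma tVecBoost_outer (i j : Fin 3) : 3 * (tVecBoost i * star (tVecBoost j)) =
    (![xi, xi ^ 6, xi ^ 11] : Fin 3 → ℂ) i * (![xi ^ 8, xi ^ 3, xi ^ 7] : Fin 3 → ℂ) j := by
  have h3 : star (xi ^ 3) = xi ^ 6 := by
    rw [star_pow, star_xi]
    linear_combination (xi ^ 15 + xi ^ 6) * xi_pow_nine
  have hs : star ((![1, xi ^ 6, xi ^ 3] : Fin 3 → ℂ) j) = (![1, xi ^ 3, xi ^ 6] : Fin 3 → ℂ) j := by
    fin_cases j
    · exact star_one _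
    · change star (xi ^ 6) = xi ^ 3
      rw [← h3, star_star]
    · exact h3
  have e := tVec_outer i j
  rw [tVecBoost, tVecBoost, star_mul', hs]
  calc _ = (![1, xi ^ 6, xi ^ 3] : Fin 3 → ℂ) i * (![1, xi ^ 3, xi ^ 6] : Fin 3 → ℂ) j *
        (3 * ((tVec : Fin 3 → ℂ) i * star ((tVec : Fin 3 → ℂ) j))) := by ring
    _ = _ := by
      rw [e]
      clear e hs
      fin_cases i <;> fin_cases j <;> simp <;> ring

/-- The operator `|φ⟩⟨φ|`. -/
def pureOp {A : QSystem} (φ : A.Basis → ℂ) : Op A := vecMulVec φ (star φ)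

lemma three_mul_trace_phaseOp_qutrit_mul (a b : Fin 3) (φ : Fin 3 → ℂ) :
    3 * (phaseOp qutrit (a, b) * pureOp (A := qutrit) φ).trace =
      ∑ i : Fin 3, ∑ j : Fin 3, (if i + j = 2 * b then
        (![1, xi ^ 3, xi ^ 6] : Fin 3 → ℂ) (a * (i - j)) else 0) * (3 * (φ j * star (φ i))) := by
  have h : (phaseOp qutrit (a, b) * pureOp (A := qutrit) φ).trace =
      ∑ i : Fin 3, ∑ j : Fin 3, (if i + j = 2 * b then
        (![1, xi ^ 3, xi ^ 6] : Fin 3 → ℂ) (a * (i - j)) else 0) * (φ j * star (φ i)) := by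
    change ∑ i : Fin 3, ∑ j : Fin 3, (phaseOp qutrit (a, b) : Matrix (Fin 3) (Fin 3) ℂ) i j *
      (φ j * star (φ i)) = _
    refine Finset.sum_congr rfl fun i _ => Finset.sum_congr rfl fun j _ => ?_
    refine congrArg₂ (· * ·) ?_ rfl
    refine (phaseOp_qudit_apply (p := 3) _ _ _ _ _).trans ?_
    exact if_congr Iff.rfl (stdAddChar_three_eq _) rfl
  rw [h, Finset.mul_sum]
  refine Finset.sum_congr rfl fun i _ => ?_
  rw [Finset.mul_sum]
  exact Finset.sum_congr rfl fun j _ => by ring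

/-- The values are `1 + 2 cos` of 40°, 160° and 80°. The boost is `Z²` (as `ω = ξ³`), which
translates the Wigner function and permutes these values cyclically. -/
lemma trace_phaseOp_mul_tVec (a b : Fin 3) :
    let f := fun φ : Fin 3 → ℂ =>
      3 * (phaseOp qutrit (a, b) * pureOp (A := qutrit) φ).trace
    (f tVec = 1 + xi + xi ^ 8 ∧ f tVecBoost = 1 + xi ^ 4 + xi ^ 5) ∨
    (f tVec = 1 + xi ^ 4 + xi ^ 5 ∧ f tVecBoost = 1 + xi ^ 2 + xi ^ 7) ∨
    (f tVec = 1 + xi ^ 2 + xi ^ 7 ∧ f tVecBoost = 1 + xi + xi ^ 8) := by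
  intro f
  have k1 : f tVec = _ := three_mul_trace_phaseOp_qutrit_mul a b tVec
  have k2 : f tVecBoost = _ := three_mul_trace_phaseOp_qutrit_mul a b tVecBoost
  clear_value f
  simp only [tVec_outer] at k1
  simp only [tVecBoost_outer] at k2
  rw [k1, k2]
  clear k1 k2 f
  -- At all nine phase points the identities follow from `z ^ 9 = 1` alone.
  have h9 := xi_pow_nine
  generalize xi = z at h9
  fin_cases a <;> fin_cases b <;> simp [Fin.sum_univ_three] <;>
    first
    | exact Or.inl ⟨by grind, by grind⟩
    | exact Or.inr (Or.inl ⟨by grind, by grind⟩)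
    | exact Or.inr (Or.inr ⟨by grind, by grind⟩)

/-- A positive operator above `|T⟩⟨T|` whose phase-space values are small. -/
noncomputable def tWitness : Op qutrit :=
  pureOp tVec + ((2 * Real.sin (Real.pi / 18) : ℝ) : ℂ) • pureOp (A := qutrit) tVecBoost

/-- The triple-angle formula for `2 cos 80°`: `x³ - 3x = 2 cos 240° = -1`. -/
lemma two_sin_cubic :
    (2 * Real.sin (Real.pi / 18)) ^ 3 - 3 * (2 * Real.sin (Real.pi / 18)) + 1 = 0 := by
  have h := two_sin_eq_xi
  have h2 : (((2 * Real.sin (Real.pi / 18)) ^ 3 - 3 * (2 * Real.sin (Real.pi / 18)) + 1 : ℝ) : ℂ)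
      = 0 := by
    rw [Complex.ofReal_add, Complex.ofReal_sub, Complex.ofReal_pow, Complex.ofReal_mul 3, h]
    have h9 := xi_pow_nine
    have hc := xi_cyclotomic
    generalize xi = z at h9 hc
    push_cast
    grind
  exact_mod_cast h2

lemma sin_pi_div_eighteen_pos : 0 < Real.sin (Real.pi / 18) :=
  Real.sin_pos_of_pos_of_lt_pi (by positivity) (by linarith [Real.pi_pos])

lemma two_sin_le_one : 2 * Real.sin (Real.pi / 18) ≤ 1 := by
  have := Real.sin_le (x := Real.pi / 18) (by positivity)
  linarith [Real.pi_le_four]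

/-- The weight `s = 2 sin(π/18)` of the boosted state equalizes the two largest of the three values:
modulo the cubic for `s` both are `(2 + s - s²)/3 = 1/(1+s)`, and the third is smaller in modulus.
-/
lemma norm_trace_phaseOp_mul_tWitness_le (u : qutrit.Phase) :
    ‖(phaseOp qutrit u * tWitness).trace‖ ≤ 1 / (1 + 2 * Real.sin (Real.pi / 18)) := by
  obtain ⟨a, b⟩ := u
  have h := trace_phaseOp_mul_tVec a b
  have e : (phaseOp qutrit (a, b) * tWitness).trace =
      (phaseOp qutrit (a, b) * pureOp (A := qutrit) tVec).trace +
        ((2 * Real.sin (Real.pi / 18) : ℝ) : ℂ) *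
          (phaseOp qutrit (a, b) * pureOp (A := qutrit) tVecBoost).trace := by
    rw [tWitness, mul_add, Matrix.mul_smul, trace_add, trace_smul, smul_eq_mul]
  rw [e]
  have hx := two_sin_eq_xi
  have hs0 : 0 < 2 * Real.sin (Real.pi / 18) := mul_pos two_pos sin_pi_div_eighteen_pos
  have hs1 := two_sin_le_one
  have hs3 := two_sin_cubic
  have h9 := xi_pow_nine
  have hc := xi_cyclotomic
  have hT : ∀ φ : Fin 3 → ℂ, (phaseOp qutrit (a, b) * pureOp (A := qutrit) φ).trace =
    (1 / 3) * (3 * (phaseOp qutrit (a, b) * pureOp (A := qutrit) φ).trace) := fun φ => by ring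
  rw [hT tVec, hT tVecBoost]
  dsimp only at h
  generalize 3 * (phaseOp qutrit (a, b) * pureOp (A := qutrit) tVec).trace = x at h
  generalize 3 * (phaseOp qutrit (a, b) * pureOp (A := qutrit) tVecBoost).trace = y at h
  generalize 2 * Real.sin (Real.pi / 18) = s at *
  generalize xi = z at *
  have a1 : 1 + z + z ^ 8 = ((3 - s - s ^ 2 : ℝ) : ℂ) := by
    push_cast; rw [hx]; grind
  have a2 : 1 + z ^ 4 + z ^ 5 = ((s ^ 2 - 1 : ℝ) : ℂ) := by
    push_cast; rw [hx]; grind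
  have a3 : 1 + z ^ 2 + z ^ 7 = ((1 + s : ℝ) : ℂ) := by
    push_cast; rw [hx]; grind
  rw [a1, a2, a3] at h
  have hq : 1 / (1 + s) = (2 + s - s ^ 2) / 3 := by
    field_simp
    linear_combination hs3
  rw [hq]
  have eR : ∀ p q : ℝ, 1 / 3 * (p : ℂ) + (s : ℂ) * (1 / 3 * (q : ℂ)) =
      (((p + s * q) / 3 : ℝ) : ℂ) := fun p q => by push_cast; ring
  rcases h with ⟨rfl, rfl⟩ | ⟨rfl, rfl⟩ | ⟨rfl, rfl⟩ <;>
    rw [eR, Complex.norm_real, Real.norm_eq_abs, abs_le] <;>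
    constructor <;> nlinarith

/-! ### Tensor powers -/

/-- Tensor powers of an operator. -/
def opPow {M : QSystem} (Y : Op M) : (k : ℕ) → Op (M.pow k)
  | 0 => (1 : Op unit)
  | k + 1 => kronecker (opPow Y k) Y

lemma pureOp_posSemidef {A : QSystem} (φ : A.Basis → ℂ) : (pureOp φ).PosSemidef :=
  posSemidef_vecMulVec_self_star φ

lemma pureOp_vecPow_succ {M : QSystem} (φ : M.Basis → ℂ) (k : ℕ) :
    pureOp (vecPow φ (k + 1)) = kronecker (pureOp (vecPow φ k)) (pureOp φ) := by
  ext x y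
  change vecPow φ k x.1 * φ x.2 * star (vecPow φ k y.1 * φ y.2) =
    (vecPow φ k x.1 * star (vecPow φ k y.1)) * (φ x.2 * star (φ y.2))
  rw [star_mul']
  ring

lemma pureOp_vecPow_zero {M : QSystem} (φ : M.Basis → ℂ) :
    pureOp (vecPow φ 0) = (1 : Op unit) := by
  ext x y
  change (1 : ℂ) * star 1 = 1
  simp

lemma opPow_sub_pureOp_posSemidef {M : QSystem} {Y : Op M} {φ : M.Basis → ℂ}
    (hY : Y.PosSemidef) (h : (Y - pureOp φ).PosSemidef) (k : ℕ) :
    (opPow Y k - pureOp (vecPow φ k)).PosSemidef := by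
  induction k with
  | zero =>
    rw [pureOp_vecPow_zero]
    change ((1 : Op unit) - 1).PosSemidef
    rw [sub_self]
    exact Matrix.PosSemidef.zero
  | succ k ih =>
    -- Telescoping one tensor factor writes the difference as a sum of products of positive
    -- operators.
    have e : opPow Y (k + 1) - pureOp (vecPow φ (k + 1)) =
        kronecker (opPow Y k - pureOp (vecPow φ k)) Y +
          kronecker (pureOp (vecPow φ k)) (Y - pureOp φ) := by
      rw [pureOp_vecPow_succ]
      ext x y
      change opPow Y k x.1 y.1 * Y x.2 y.2 - pureOp (vecPow φ k) x.1 y.1 * pureOp φ x.2 y.2 =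
        (opPow Y k x.1 y.1 - pureOp (vecPow φ k) x.1 y.1) * Y x.2 y.2 +
          pureOp (vecPow φ k) x.1 y.1 * (Y x.2 y.2 - pureOp φ x.2 y.2)
      ring
    rw [e]
    exact (ih.kronecker hY).add ((pureOp_posSemidef _).kronecker h)

lemma norm_trace_phaseOp_mul_opPow_le {M : QSystem} {Y : Op M} {q : ℝ}
    (h : ∀ u, ‖(phaseOp M u * Y).trace‖ ≤ q) (k : ℕ) (u : (M.pow k).Phase) :
    ‖(phaseOp (M.pow k) u * opPow Y k).trace‖ ≤ q ^ k := by
  induction k with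
  | zero =>
    have e : (phaseOp unit u * 1).trace = 1 := by rw [mul_one]; exact phaseOp_trace unit u
    exact (congrArg norm e).le.trans (by simp)
  | succ k ih =>
    have e : (phaseOp (M.pow (k + 1)) u * opPow Y (k + 1)).trace =
        (phaseOp (M.pow k) u.1 * opPow Y k).trace * (phaseOp M u.2 * Y).trace :=
      trace_phaseOp_mul_kronecker (A := M.pow k) (B := M) _ _ u
    rw [e, norm_mul, pow_succ]
    exact mul_le_mul (ih _) (h _) (norm_nonneg _) ((norm_nonneg _).trans (ih u.1))

/-! ### Fidelity bounds -/

lemma trace_mul_nonneg_of_posSemidef {n : Type*} [Fintype n] [DecidableEq n] {X Y : Matrix n n ℂ}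
    (hX : X.PosSemidef) (hY : Y.PosSemidef) : 0 ≤ (X * Y).trace := by
  obtain ⟨C, rfl⟩ : ∃ C : Matrix n n ℂ, Y = C * Cᴴ := by
    open scoped MatrixOrder Matrix.Norms.L2Operator in
    exact CStarAlgebra.nonneg_iff_eq_mul_star_self.mp hY.nonneg
  rw [← mul_assoc, trace_mul_comm, ← mul_assoc]
  exact (hX.conjTranspose_mul_mul_same C).trace_nonneg

/-- Duality of ℓ¹ and ℓ^∞ in the basis of point operators. -/
lemma norm_trace_mul_le_of_wignerTraceNorm {A : QSystem} {X Y : Op A} {q : ℝ}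
    (hX : wignerTraceNorm X ≤ 1) (hY : ∀ u, ‖(phaseOp A u * Y).trace‖ ≤ q) (hq : 0 ≤ q) :
    ‖(X * Y).trace‖ ≤ q := by
  have e : (X * Y).trace = ∑ u, wigner X u * (phaseOp A u * Y).trace := by
    conv_lhs => rw [← sum_wigner_smul_phaseOp X]
    simp only [Finset.sum_mul, Matrix.smul_mul, trace_sum, trace_smul, smul_eq_mul]
  have h : ‖(X * Y).trace‖ₑ ≤ ENNReal.ofReal q := by
    calc ‖(X * Y).trace‖ₑ ≤ ∑ u, ‖wigner X u‖ₑ * ‖(phaseOp A u * Y).trace‖ₑ := by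
          rw [e]
          exact (enorm_sum_le _ _).trans (Finset.sum_le_sum fun u _ => (enorm_mul _ _).le)
      _ ≤ ∑ u, ‖wigner X u‖ₑ * ENNReal.ofReal q := by
          gcongr with u
          rw [← ofReal_norm]
          exact ENNReal.ofReal_le_ofReal (hY u)
      _ = wignerTraceNorm X * ENNReal.ofReal q := (Finset.sum_mul _ _ _).symm
      _ ≤ 1 * ENNReal.ofReal q := by gcongr
      _ = ENNReal.ofReal q := one_mul _
  rw [← ofReal_norm] at h
  exact (ENNReal.ofReal_le_ofReal_iff hq).mp h

lemma fidelityWith_eq_trace {A : QSystem} (φ : A.Basis → ℂ) (X : Op A) :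
    fidelityWith φ X = (pureOp φ * X).trace.re := by
  rw [fidelityWith, pureOp, vecMulVec_mul, trace_vecMulVec, dotProduct_comm φ, dotProduct_mulVec]

/-- The projector is replaced by the larger witness power, using positivity of `X`; duality then
bounds the trace. -/
lemma fidelityWith_tVec_le {k : ℕ} {X : Op (qutrit.pow k)} (hX : X.PosSemidef)
    (hW : wignerTraceNorm X ≤ 1) :
    fidelityWith (vecPow tVec k) X ≤ (1 / (1 + 2 * Real.sin (Real.pi / 18))) ^ k := by
  have hs := sin_pi_div_eighteen_pos
  have h1 : (((2 * Real.sin (Real.pi / 18) : ℝ) : ℂ) •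
      pureOp (A := qutrit) tVecBoost).PosSemidef :=
    (pureOp_posSemidef _).smul (Complex.zero_le_real.mpr (by positivity))
  have h2 : (tWitness - pureOp tVec).PosSemidef := by
    rw [tWitness, add_sub_cancel_left]; exact h1
  have h3 : tWitness.PosSemidef := (pureOp_posSemidef _).add h1
  have h4 := trace_mul_nonneg_of_posSemidef (opPow_sub_pureOp_posSemidef h3 h2 k) hX
  rw [sub_mul, trace_sub] at h4
  have h5 := (Complex.nonneg_iff.mp h4).1
  rw [Complex.sub_re] at h5
  have h6 := norm_trace_mul_le_of_wignerTraceNorm hW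
    (norm_trace_phaseOp_mul_opPow_le norm_trace_phaseOp_mul_tWitness_le k) (by positivity)
  rw [trace_mul_comm] at h6
  rw [fidelityWith_eq_trace]
  linarith [Complex.re_le_norm (opPow tWitness k * X).trace]

/-! ### The bounds on protocols and rates -/

lemma logConst_pos : 0 < logConst :=
  Real.logb_pos one_lt_two (by linarith [sin_pi_div_eighteen_pos])

lemma IsDistillation.mul_logConst_le {A B : QSystem} {N E : Op A →ₗ[ℂ] Op B} {n k : ℕ} {ε l : ℝ}
    {P : DistProtocol A B (qutrit.pow k) n} (hP : IsDistillation tVec N n k ε P) (hε : ε < 1)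
    (hN : IsCP N) (hE : IsCP E) (hE' : mana E ≤ 0)
    (h : IsCP ((((2 : ℝ) ^ l : ℝ) : ℂ) • E - N)) :
    k * logConst ≤ n * l + Real.logb 2 (1 / (1 - ε)) := by
  have hc : (0 : ℝ) < (2 : ℝ) ^ l := Real.rpow_pos_of_pos two_pos l
  have hs : 0 < 1 + 2 * Real.sin (Real.pi / 18) := by linarith [sin_pi_div_eighteen_pos]
  have h1 := trace_mul_nonneg_of_posSemidef (pureOp_posSemidef (vecPow tVec k))
    (P.smul_output_sub_posSemidef hN hE hc.le h)
  rw [mul_sub, trace_sub, Matrix.mul_smul, trace_smul, smul_eq_mul] at h1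
  have h2 := (Complex.nonneg_iff.mp h1).1
  rw [Complex.sub_re, Complex.re_ofReal_mul, ← fidelityWith_eq_trace,
    ← fidelityWith_eq_trace] at h2
  have h3 := fidelityWith_tVec_le (P.output_posSemidef hE) (P.wignerTraceNorm_output_le hE')
  have h4 : 1 - ε ≤ ((2 : ℝ) ^ l) ^ n * (1 / (1 + 2 * Real.sin (Real.pi / 18))) ^ k := by
    have hP' : 1 - ε ≤ fidelityWith (vecPow tVec k) (P.output N) := hP
    have := mul_le_mul_of_nonneg_left h3 (pow_pos hc n).le
    linarith
  have h5 := Real.logb_le_logb_of_le one_lt_two (by linarith) h4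
  rw [Real.logb_mul (pow_pos hc n).ne' (pow_pos (one_div_pos.mpr hs) k).ne', Real.logb_pow,
    Real.logb_pow, Real.logb_rpow two_pos (by norm_num), one_div, Real.logb_inv] at h5
  rw [one_div, Real.logb_inv]
  change _ * Real.logb 2 _ ≤ _
  linarith

lemma IsDistillation.le_maxThauma {A B : QSystem} {N : Op A →ₗ[ℂ] Op B} (hN : IsChannel N)
    {n k : ℕ} {ε : ℝ} {P : DistProtocol A B (qutrit.pow k) n}
    (hP : IsDistillation tVec N n k ε P) (hε : ε < 1) :
    (((k * logConst - Real.logb 2 (1 / (1 - ε))) / n : ℝ) : EReal) ≤ maxThauma N := by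
  refine le_iInf fun E => ?_
  by_contra h
  obtain ⟨l, hl, hcp⟩ := exists_isCP_of_dMaxMap_lt (not_le.mp h)
  have h1 := hP.mul_logConst_le hε hN.1 E.2.1 E.2.2 hcp
  have hn : (0 : ℝ) < n := Nat.cast_pos.mpr P.pos
  have h2 : (k * logConst - Real.logb 2 (1 / (1 - ε))) / n ≤ l := by
    rw [div_le_iff₀ hn]; linarith
  exact absurd (EReal.coe_lt_coe_iff.mp hl) (not_lt.mpr h2)

lemma log2_ofReal {x : ℝ} (hx : 0 < x) : log2 (ENNReal.ofReal x) = (Real.logb 2 x : EReal) := by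
  rw [log2, ENNReal.log_ofReal_of_pos hx, ← EReal.coe_div]
  rfl

lemma IsDistillation.rate_le {A B : QSystem} {N : Op A →ₗ[ℂ] Op B} (hN : IsChannel N)
    {n k : ℕ} {ε : ℝ} (hε : ε ≤ 1) {P : DistProtocol A B (qutrit.pow k) n}
    (hP : IsDistillation tVec N n k ε P) :
    (((k : ℝ) / (n : ℝ) : ℝ) : EReal) ≤
      1 / (logConst : EReal) *
        (maxThauma N + log2 (1 / ENNReal.ofReal (1 - ε)) / (n : EReal)) := by
  have hc := logConst_pos
  have hn : (0 : ℝ) < n := Nat.cast_pos.mpr P.pos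
  have hnE : (n : EReal) = ((n : ℝ) : EReal) := (EReal.coe_natCast (n := n)).symm
  -- In `EReal`, `⊥ + ⊤ = ⊥`, so without this the bound at `ε = 1` would not be trivial.
  have hθ : maxThauma N ≠ ⊥ := fun h => absurd (maxThauma_nonneg hN) (by rw [h]; simp)
  have htop : (1 : EReal) / (logConst : EReal) * ⊤ = ⊤ := by
    rw [← EReal.coe_one, ← EReal.coe_div]
    exact EReal.coe_mul_top_of_pos (by positivity)
  rcases hε.lt_or_eq with hε | rfl
  · have hL : log2 (1 / ENNReal.ofReal (1 - ε)) = (Real.logb 2 (1 / (1 - ε)) : EReal) := by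
      rw [one_div, ← ENNReal.ofReal_inv_of_pos (by linarith), ← one_div,
        log2_ofReal (one_div_pos.mpr (by linarith))]
    have h := hP.le_maxThauma hN hε
    rw [hL, hnE, ← EReal.coe_div]
    induction hθ' : maxThauma N with
    | bot => exact absurd hθ' hθ
    | top => rw [EReal.top_add_coe, htop]; exact le_top
    | coe t =>
      rw [hθ', EReal.coe_le_coe_iff] at h
      rw [← EReal.coe_one, ← EReal.coe_div, ← EReal.coe_add, ← EReal.coe_mul,
        EReal.coe_le_coe_iff, div_mul_eq_mul_div, one_mul, le_div_iff₀ hc]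
      rw [sub_div] at h
      linarith [div_mul_eq_mul_div (k : ℝ) n logConst]
  · have hL : log2 (1 / ENNReal.ofReal (1 - 1)) / (n : EReal) = ⊤ := by
      have : 1 / ENNReal.ofReal (1 - 1) = ⊤ := by simp
      rw [this, log2, ENNReal.log_top, EReal.top_div_of_pos_ne_top
        (EReal.coe_pos.mpr (Real.log_pos one_lt_two)) (EReal.coe_ne_top _), hnE,
        EReal.top_div_of_pos_ne_top (EReal.coe_pos.mpr hn) (EReal.coe_ne_top _)]
    rw [hL, EReal.add_top_of_ne_bot hθ, htop]
    exact le_top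

lemma distillableMagic_le {A B : QSystem} {N : Op A →ₗ[ℂ] Op B} (hN : IsChannel N) :
    distillableMagic tVec N ≤ maxThauma N / (logConst : EReal) := by
  have hc := logConst_pos
  refine sSup_le ?_
  rintro _ ⟨r, hr, rfl⟩
  have hθ : maxThauma N ≠ ⊥ := fun h => absurd (maxThauma_nonneg hN) (by rw [h]; simp)
  induction hθ' : maxThauma N with
  | bot => exact absurd hθ' hθ
  | top =>
    rw [EReal.top_div_of_pos_ne_top (EReal.coe_pos.mpr hc) (EReal.coe_ne_top _)]
    exact le_top
  | coe t =>
    rw [← EReal.coe_div, EReal.coe_le_coe_iff]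
    refine le_of_forall_pos_le_add fun δ hδ => ?_
    -- Any fixed error below 1 would do; `1/2` makes the error term `logb 2 2 = 1`. Half of `δ` pays
    -- for the rate slack, the other half absorbs this 1 once `n * (logConst * (δ / 2)) ≥ 1`.
    have h1 := hr (1 / 2) (by norm_num) (by norm_num) (δ / 2) (by positivity)
    have h2 : ∀ᶠ n : ℕ in Filter.atTop, 1 / (logConst * (δ / 2)) ≤ (n : ℝ) :=
      tendsto_natCast_atTop_atTop.eventually_ge_atTop _
    obtain ⟨n, ⟨k, hk, P, hP⟩, hn2⟩ := (h1.and h2).exists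
    have hn : (0 : ℝ) < n := Nat.cast_pos.mpr P.pos
    have h3 := hP.le_maxThauma hN (by norm_num)
    rw [hθ', EReal.coe_le_coe_iff, show (1 : ℝ) / (1 - 1 / 2) = 2 by norm_num,
      Real.logb_self_eq_one one_lt_two, div_le_iff₀ hn] at h3
    rw [div_le_iff₀ (by positivity)] at hn2
    have h4 : n * (r - δ) * logConst ≤ n * t := by
      have := mul_le_mul_of_nonneg_right hk hc.le
      nlinarith
    have h5 : (r - δ) * logConst ≤ t := by
      rw [mul_assoc] at h4
      exact le_of_mul_le_mul_left h4 hn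
    have := (le_div_iff₀ hc).mpr h5
    linarith

end MagicDistillation

theorem mainTheorem9 (A B : QSystem) (N : Op A →ₗ[ℂ] Op B) (hN : IsChannel N) :
    (∀ (n k : ℕ) (ε : ℝ), 0 ≤ ε → ε ≤ 1 →
      ∀ P : DistProtocol A B (qutrit.pow k) n, IsDistillation tVec N n k ε P →
        (((k : ℝ) / (n : ℝ) : ℝ) : EReal) ≤
          1 / (logConst : EReal) *
            (maxThauma N + log2 (1 / ENNReal.ofReal (1 - ε)) / (n : EReal))) ∧
    distillableMagic tVec N ≤ maxThauma N / (logConst : EReal) :=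
  ⟨fun _ _ _ _ hε _ hP => hP.rate_le hN hε, distillableMagic_le hN⟩
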